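/- **Proposition 3.2.** Let $\alpha,\beta\in(0,1]$, $p\in[1,2)$ and let $\theta_0\in L^2(\mathbb R^2)\cap L^p(\mathbb R^2)$ be real-valued. Consider the surface quasi-geostrophic equation $$\partial_t\theta+u\cdot\nabla\theta+\mathcal L\theta=0,\qquad u=(-\partial_{x_2}\Lambda^{-1}\theta,\ \partial_{x_1}\Lambda^{-1}\theta),\qquad \theta(\cdot,0)=\theta_0,$$ on $\mathbb R^2\times[0,\infty)$, where $\mathcal L=\Lambda_{x_1}^{2\alpha}+\Lambda_{x_2}^{2\beta}$ or, if $\alpha=\beta$, also $\mathcal L=\Lambda^{2\alpha}$. Here $\Lambda_{x_j}^{s}$ and $\Lambda^s$ are the Fourier multipliers with symbols $|\xi_j|^s$ and $|\xi|^s$ (for the Fourier transform with kernel $e^{-ix\cdot\xi}$). Write $D(f)=\|\Lambda_{x_1}^{\alpha}f\|_{L^2}^2+\|\Lambda_{x_2}^{\beta}f\|_{L^2}^2$ (respectively $D(f)=\|\Lambda^\alpha f\|_{L^2}^2$ in the case $\mathcal L=\Lambda^{2\alpha}$), with $D(f)=\infty$ if these are not in $L^2$. A *weak solution* is a strongly measurable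 real-valued $\theta:[0,\infty)\to L^2(\mathbb R^2)$ such that 1. for all $\varphi\in\mathcal S(\mathbb R^2)$ and all $t\ge0$, $$\int\theta(t)\varphi\,dx=\int\theta_0\varphi\,dx+\int_0^t\!\!\int\theta\,u\cdot\nabla\varphi\,dx\,ds-\int_0^t\!\!\int\theta\,\mathcal L\varphi\,dx\,ds;$$ 2. (energy inequality) for almost every $s\geq 0$ and all $t\ge s$, $\ \|\theta(t)\|_{L^2}^2+2\int_s^tD(\theta(\tau))\,d\tau\le\|\theta(s)\|_{L^2}^2$; and the same holds for $s=0$ and all $t\ge 0$, with $\theta_0$ in place of $\theta(s)$. Then there is a constant $C_0>0$, depending only on $\alpha,\beta,p$ and $\theta_0$, such that every weak solution with initial value $\theta_0$ satisfies $$\|\theta(t)\|_{L^2}\le C_0(1+t)^{-\frac{(\alpha+\beta)(2-p)}{4\alpha\beta p}}\qquad\text{for all }t\ge0 .$$ -/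

import Mathlib

open MeasureTheory Set
open scoped FourierTransform SchwartzMap ENNReal

namespace AnisoSQG

/-- The plane `ℝ²` with its Euclidean norm. -/
abbrev Plane : Type := EuclideanSpace ℝ (Fin 2)

/-- Real-valued `L²(ℝ²)`. -/
abbrev L2R : Type := Lp ℝ 2 (volume : Measure Plane)

/-- Complex-valued `L²(ℝ²)`. -/
abbrev L2C : Type := Lp ℂ 2 (volume : Measure Plane)

/-- A real-valued `L²` function, regarded as a complex-valued one. -/
noncomputable def toComplex (f : L2R) : L2C := Complex.ofRealCLM.compLp f

open Classical in
/-- The Fourier multiplier operator `f ↦ 𝓕⁻¹ (m · 𝓕 f)` on its natural domain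
`{f ∈ L² : m · 𝓕 f ∈ L²}` (extended by `0` outside of the domain). Here `𝓕` is the unitary Fourier
transform of Mathlib, with kernel `exp (- 2 π i x · ξ)`; thus `∂_j` has the symbol `2 π i ξ_j`. -/
noncomputable def multiplier (m : Plane → ℂ) (f : L2C) : L2C :=
  if h : MemLp (fun ξ => m ξ * (𝓕 f : L2C) ξ) 2 (volume : Measure Plane) then
    𝓕⁻ (h.toLp (fun ξ => m ξ * (𝓕 f : L2C) ξ))
  else 0

/-- The symbol of `Λ_{x₁}^{2α} + Λ_{x₂}^{2β}`. -/
noncomputable def anisotropicSymbol (α β : ℝ) (ξ : Plane) : ℝ :=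
  |2 * Real.pi * ξ 0| ^ (2 * α) + |2 * Real.pi * ξ 1| ^ (2 * β)

/-- The symbol of `Λ^{2α} = (-Δ)^α`. -/
noncomputable def isotropicSymbol (α : ℝ) (ξ : Plane) : ℝ :=
  (2 * Real.pi * ‖ξ‖) ^ (2 * α)

/-- The symbols of the two components of `∇^⊥ Λ⁻¹ = (-∂₂ Λ⁻¹, ∂₁ Λ⁻¹)`. They are homogeneous of
degree `0`, so that the factors `2 π` cancel. -/
noncomputable def velocitySymbol (j : Fin 2) (ξ : Plane) : ℂ :=
  if j = 0 then -(Complex.I * (ξ 1 : ℂ) / (‖ξ‖ : ℂ)) else Complex.I * (ξ 0 : ℂ) / (‖ξ‖ : ℂ)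

/-- The velocity `u = (-∂₂ Λ⁻¹ f, ∂₁ Λ⁻¹ f)`. -/
noncomputable def velocity (f : L2R) (j : Fin 2) : L2C :=
  multiplier (velocitySymbol j) (toComplex f)

/-- `∫ f (u · ∇φ) dx`, where `u` is the velocity of `f`. -/
noncomputable def transport (f : L2R) (φ : 𝓢(Plane, ℂ)) : ℂ :=
  ∑ j : Fin 2, ∫ x : Plane,
    toComplex f x * velocity f j x * fderiv ℝ φ x (EuclideanSpace.single j (1 : ℝ))

/-- `∫ f g dx` (bilinear, no complex conjugation). -/
noncomputable def pairing (f : L2R) (g : L2C) : ℂ := ∫ x : Plane, toComplex f x * g x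

/-- The dissipation `∫ m |𝓕 f|² dξ`, possibly infinite. By Plancherel it is
`‖Λ_{x₁}^α f‖² + ‖Λ_{x₂}^β f‖²` when `m` is the symbol of `Λ_{x₁}^{2α} + Λ_{x₂}^{2β}`, and
`‖Λ^α f‖²` when `m` is the symbol of `Λ^{2α}`. -/
noncomputable def dissipation (m : Plane → ℝ) (f : L2R) : ℝ≥0∞ :=
  ∫⁻ ξ : Plane, ENNReal.ofReal (m ξ) * ‖(𝓕 (toComplex f) : L2C) ξ‖ₑ ^ 2

/-- Weak (Leray-Hopf) solutions on `[0, ∞)` of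
`∂ₜ θ + u · ∇θ + m(D) θ = 0`, `u = (-∂₂ Λ⁻¹ θ, ∂₁ Λ⁻¹ θ)`, with initial value `θ₀ ∈ L²`.
Only the values of `θ` at times `t ≥ 0` matter. The energy inequality contains the usual regularity
class: `θ` is bounded in `L²`, and the dissipation is integrable in time. -/
structure IsWeakSolution (m : Plane → ℝ) (θ₀ : L2R) (θ : ℝ → L2R) : Prop where
  measurable : AEStronglyMeasurable θ (volume.restrict (Ici (0 : ℝ)))
  /-- The equation in the sense of distributions, integrated over `[0, t]`, together with the
  initial condition (`u` is divergence free, so `u · ∇θ = ∇ · (θ u)`). -/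
  weak_form : ∀ φ : 𝓢(Plane, ℂ), ∀ t : ℝ, 0 ≤ t →
    pairing (θ t) (φ.toLp 2) = pairing θ₀ (φ.toLp 2)
      + (∫ s in (0 : ℝ)..t, transport (θ s) φ)
      - ∫ s in (0 : ℝ)..t, pairing (θ s) (multiplier (fun ξ => (m ξ : ℂ)) (φ.toLp 2))
  /-- The energy inequality starting from time `0`. -/
  energy_zero : ∀ t : ℝ, 0 ≤ t →
    ‖θ t‖ₑ ^ 2 + 2 * ∫⁻ τ in Icc 0 t, dissipation m (θ τ) ≤ ‖θ₀‖ₑ ^ 2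
  /-- The energy inequality starting from almost every later time. -/
  energy : ∀ᵐ s ∂(volume.restrict (Ici (0 : ℝ))), ∀ t : ℝ, s ≤ t →
    ‖θ t‖ₑ ^ 2 + 2 * ∫⁻ τ in Icc s t, dissipation m (θ τ) ≤ ‖θ s‖ₑ ^ 2

end AnisoSQG

/-!
The proof is Schonbek's Fourier splitting method. Split frequencies at the level `κ / (1 + t)` of
the symbol. Above it the dissipation dominates `κ / (1 + t)` times the energy. Below it, testing the
equation with functions of bounded frequency shows that the initial value contributes
`(1 + t) ^ (-r)` to `‖θ‖²`, since `θ₀ ∈ Lᵖ`, and that the nonlinearity contributes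
`(1 + t) ^ (-(1 + σ)) (∫₀ᵗ ‖θ‖²)²`, with `r = σ (2 / p - 1)` and `σ = 1 / (2α) + 1 / (2β)` the
homogeneous dimension; Gronwall's inequality only costs a constant, because the level times `t` is
bounded.

This is bootstrapped in three steps. The coefficient of the nonlinear term tends to `0` with `κ`,
so `‖θ‖² → 0` uniformly among solutions and `∫₀ᵗ ‖θ‖² ≤ C + ε t`. Bounding one of the two factors
`∫₀ᵗ ‖θ‖²` in this way, the nonlinear term can be absorbed, which gives a decay of order
`min r (1 / 2)`. With this decay in both factors the nonlinear term is `O((1 + t) ^ (-r))`.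
-/

namespace AnisoSQG

/-! ### The integrated differential inequality -/

section SplitEnergy

variable {E r σ : ℝ} {A B y : ℝ → ℝ}

theorem nonpos_of_energy {w h : ℝ → ℝ} {T : ℝ} (hT : 0 ≤ T) (hh : ∀ τ ∈ Icc 0 T, 0 ≤ h τ)
    (hint : IntervalIntegrable (fun τ => h τ * w τ) volume 0 T)
    (hzero : w T + ∫ τ in (0 : ℝ)..T, h τ * w τ ≤ 0)
    (henergy : ∀ᵐ s ∂(volume.restrict (Icc 0 T)), w T + ∫ τ in s..T, h τ * w τ ≤ w s) :
    w T ≤ 0 := by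
  by_contra! hw
  set v : ℝ → ℝ := fun s => w T + ∫ τ in s..T, h τ * w τ with hv
  have hcont : ContinuousOn v (Icc 0 T) := by
    rw [intervalIntegrable_iff_integrableOn_Icc_of_le hT, ← uIcc_of_le hT] at hint
    have := intervalIntegral.continuousOn_primitive_interval_left hint
    rw [uIcc_of_le hT] at this
    exact continuousOn_const.add this
  -- Past the last time `a` with `v a ≤ 0` one has `0 < v ≤ w`, whence `v a ≥ w T > 0`.
  set Z : Set ℝ := Icc 0 T ∩ v ⁻¹' Iic 0
  have hZ : IsCompact Z := isCompact_Icc.of_isClosed_subset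
    (hcont.preimage_isClosed_of_isClosed isClosed_Icc isClosed_Iic) inter_subset_left
  obtain ⟨⟨ha₀, haT⟩, hva⟩ : sSup Z ∈ Z := hZ.sSup_mem ⟨0, ⟨le_rfl, hT⟩, hzero⟩
  set a := sSup Z
  have hpos : ∀ s ∈ Ioc a T, 0 < v s := by
    intro s hs
    by_contra! hle
    exact (le_csSup hZ.bddAbove ⟨⟨ha₀.trans hs.1.le, hs.2⟩, hle⟩).not_gt hs.1
  have hnonneg : 0 ≤ ∫ τ in a..T, h τ * w τ := by
    have hsub : Ioc a T ⊆ Icc 0 T := fun s hs => ⟨ha₀.trans hs.1.le, hs.2⟩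
    rw [intervalIntegral.integral_of_le haT]
    refine setIntegral_nonneg_of_ae_restrict ?_
    filter_upwards [ae_mono (Measure.restrict_mono hsub le_rfl) henergy,
      ae_restrict_mem measurableSet_Ioc] with s hvw hs
    exact mul_nonneg (hh s (hsub hs)) ((hpos s hs).le.trans hvw)
  have : w T + ∫ τ in a..T, h τ * w τ ≤ 0 := hva
  linarith

theorem le_supersolution_of_energy {z z' h F : ℝ → ℝ} {T : ℝ} (hT : 0 ≤ T)
    (hh : ∀ τ ∈ Icc 0 T, 0 ≤ h τ) (hhc : ContinuousOn h (Icc 0 T)) (hF : ContinuousOn F (Icc 0 T))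
    (hz : ∀ t ∈ Icc 0 T, HasDerivAt z (z' t) t) (hz' : ContinuousOn z' (Icc 0 T))
    (hsuper : ∀ t ∈ Icc 0 T, -(h t * (z t - F t)) ≤ z' t) (hy : IntervalIntegrable y volume 0 T)
    (hzero : y T + ∫ τ in (0 : ℝ)..T, h τ * (y τ - F τ) ≤ z 0)
    (henergy : ∀ᵐ s ∂(volume.restrict (Icc 0 T)),
      y T + ∫ τ in s..T, h τ * (y τ - F τ) ≤ y s) :
    y T ≤ z T := by
  have hzc : ContinuousOn z (Icc 0 T) := HasDerivAt.continuousOn hz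
  have hsub : ∀ s ∈ Icc 0 T, uIcc s T ⊆ Icc 0 T := fun s hs => by
    rw [uIcc_of_le hs.2]; exact Icc_subset_Icc_left hs.1
  have hiz : ∀ s ∈ Icc 0 T, IntervalIntegrable (fun τ => h τ * (z τ - F τ)) volume s T :=
    fun s hs => ((hhc.mul (hzc.sub hF)).mono (hsub s hs)).intervalIntegrable
  have hiy : ∀ s ∈ Icc 0 T, IntervalIntegrable (fun τ => h τ * (y τ - F τ)) volume s T := by
    intro s hs
    have hys : IntervalIntegrable y volume s T :=
      hy.mono_set (by simpa only [uIcc_of_le hT] using hsub s hs)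
    exact (hys.sub (hF.mono (hsub s hs)).intervalIntegrable).continuousOn_mul
      (hhc.mono (hsub s hs))
  have hz_le : ∀ s ∈ Icc 0 T, z s ≤ z T + ∫ τ in s..T, h τ * (z τ - F τ) := by
    intro s hs
    have hi' : IntervalIntegrable z' volume s T := (hz'.mono (hsub s hs)).intervalIntegrable
    have hle := intervalIntegral.integral_mono_on hs.2 (hiz s hs).neg hi'
      fun t ht => hsuper t ⟨hs.1.trans ht.1, ht.2⟩
    rw [intervalIntegral.integral_eq_sub_of_hasDerivAt (fun t ht => hz t (hsub s hs ht)) hi'] at hle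
    simp only [Pi.neg_apply, intervalIntegral.integral_neg] at hle
    linarith
  have hdiff : ∀ s ∈ Icc 0 T, ∫ τ in s..T, h τ * (y τ - z τ) =
      (∫ τ in s..T, h τ * (y τ - F τ)) - ∫ τ in s..T, h τ * (z τ - F τ) := by
    intro s hs
    rw [← intervalIntegral.integral_sub (hiy s hs) (hiz s hs)]
    exact intervalIntegral.integral_congr fun τ _ => by ring
  have h0 : (0 : ℝ) ∈ Icc 0 T := ⟨le_rfl, hT⟩
  refine sub_nonpos.1 (nonpos_of_energy (w := fun t => y t - z t) hT hh ?_ ?_ ?_)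
  · exact ((hiy 0 h0).sub (hiz 0 h0)).congr (fun τ _ => by ring)
  · rw [hdiff 0 h0]
    linarith [hz_le 0 h0]
  · filter_upwards [henergy, ae_restrict_mem measurableSet_Icc] with s hys hs
    rw [hdiff s hs]
    linarith [hz_le s hs]

theorem hasDerivAt_one_add_rpow (ρ : ℝ) {t : ℝ} (ht : 0 ≤ t) :
    HasDerivAt (fun s : ℝ => (1 + s) ^ ρ) (ρ * (1 + t) ^ (ρ - 1)) t := by
  simpa only [id, one_mul] using
    ((hasDerivAt_id t).const_add 1).rpow_const (p := ρ)
      (Or.inl (show (1 : ℝ) + t ≠ 0 by positivity))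

theorem continuousOn_one_add_rpow (ρ T : ℝ) :
    ContinuousOn (fun t : ℝ => (1 + t) ^ ρ) (Icc 0 T) :=
  HasDerivAt.continuousOn fun _ ht => hasDerivAt_one_add_rpow ρ ht.1

theorem le_two_mul_of_absorb {ι : Type*} {s : Set ι} {f g : ι → ℝ} {C : ℝ}
    (hg : ∀ i ∈ s, 0 < g i) (hfg : ∃ M, ∀ i ∈ s, f i ≤ M * g i)
    (h : ∀ M, (∀ i ∈ s, f i ≤ M * g i) → ∀ i ∈ s, f i ≤ (C + M / 2) * g i) :
    ∀ i ∈ s, f i ≤ 2 * C * g i := by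
  intro i hi
  obtain ⟨M, hM⟩ := hfg
  have hbdd : BddAbove ((fun j => f j / g j) '' s) :=
    ⟨M, forall_mem_image.2 fun j hj => (div_le_iff₀ (hg j hj)).2 (hM j hj)⟩
  set S := sSup ((fun j => f j / g j) '' s)
  have hS : ∀ j ∈ s, f j ≤ S * g j := fun j hj =>
    (div_le_iff₀ (hg j hj)).1 (le_csSup hbdd (mem_image_of_mem _ hj))
  have hS_le : S ≤ C + S / 2 := csSup_le ⟨_, mem_image_of_mem _ hi⟩
    (forall_mem_image.2 fun j hj => (div_le_iff₀ (hg j hj)).2 (h S hS j hj))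
  calc f i ≤ S * g i := hS i hi
    _ ≤ 2 * C * g i := by gcongr; exacts [(hg i hi).le, by linarith]

theorem intervalIntegrable_of_norm_le {G : Type*} [NormedAddCommGroup G] {f : ℝ → G} {a b : ℝ}
    (hf : AEStronglyMeasurable f (volume.restrict (Ici (0 : ℝ)))) (hE : ∀ t, 0 ≤ t → ‖f t‖ ≤ E)
    (ha : 0 ≤ a) (hab : a ≤ b) : IntervalIntegrable f volume a b := by
  have hsub : Icc a b ⊆ Ici 0 := fun t ht => ha.trans ht.1
  rw [intervalIntegrable_iff_integrableOn_Icc_of_le hab]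
  refine Integrable.of_bound (hf.mono_measure (Measure.restrict_mono hsub le_rfl)) E ?_
  filter_upwards [ae_restrict_mem measurableSet_Icc] with t ht
  exact hE t (hsub ht)

/-- The bound on the low-frequency part of `y = ‖θ‖²` below the splitting level `κ / (1 + t)`:
the initial value contributes the first term, the nonlinearity the second one. -/
noncomputable def lowFrequencyBound (r σ a b : ℝ) (y : ℝ → ℝ) (t : ℝ) : ℝ :=
  a * (1 + t) ^ (-r) + b * (1 + t) ^ (-(1 + σ)) * (∫ τ in (0 : ℝ)..t, y τ) ^ 2

theorem continuousOn_lowFrequencyBound (r σ a b : ℝ) {T : ℝ} (hT : 0 ≤ T)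
    (hy : IntervalIntegrable y volume 0 T) :
    ContinuousOn (lowFrequencyBound r σ a b y) (Icc 0 T) := by
  have hY : ContinuousOn (fun t : ℝ => ∫ τ in (0 : ℝ)..t, y τ) (Icc 0 T) := by
    rw [intervalIntegrable_iff_integrableOn_Icc_of_le hT, ← uIcc_of_le hT] at hy
    simpa only [uIcc_of_le hT] using intervalIntegral.continuousOn_primitive_interval hy
  exact (continuousOn_const.mul (continuousOn_one_add_rpow _ T)).add
    ((continuousOn_const.mul (continuousOn_one_add_rpow _ T)).mul (hY.pow 2))

/-- The differential inequality `y' + 2 κ / (1 + t) (y - F) ≤ 0` of the Fourier splitting method,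
integrated over `[s, t]` for almost every `s`. It holds for every splitting parameter `κ > 0`;
`F` is the low-frequency bound with coefficients `A κ` and `B κ`, and `E` bounds `y`. -/
structure IsSplitEnergy (E r σ : ℝ) (A B y : ℝ → ℝ) : Prop where
  aestronglyMeasurable : AEStronglyMeasurable y (volume.restrict (Ici (0 : ℝ)))
  nonneg : ∀ t, 0 ≤ t → 0 ≤ y t
  le : ∀ t, 0 ≤ t → y t ≤ E
  energy_zero : ∀ κ, 0 < κ → ∀ t, 0 ≤ t → y t + ∫ τ in (0 : ℝ)..t,
    2 * (κ / (1 + τ)) * (y τ - lowFrequencyBound r σ (A κ) (B κ) y τ) ≤ E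
  energy : ∀ κ, 0 < κ → ∀ᵐ s ∂(volume.restrict (Ici (0 : ℝ))), ∀ t, s ≤ t → y t + ∫ τ in s..t,
    2 * (κ / (1 + τ)) * (y τ - lowFrequencyBound r σ (A κ) (B κ) y τ) ≤ y s

namespace IsSplitEnergy

theorem bound_nonneg (hy : IsSplitEnergy E r σ A B y) : 0 ≤ E :=
  (hy.nonneg 0 le_rfl).trans (hy.le 0 le_rfl)

theorem intervalIntegrable (hy : IsSplitEnergy E r σ A B y) {a b : ℝ} (ha : 0 ≤ a) (hab : a ≤ b) :
    IntervalIntegrable y volume a b :=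
  intervalIntegrable_of_norm_le hy.aestronglyMeasurable
    (fun t ht => (Real.norm_of_nonneg (hy.nonneg t ht)).trans_le (hy.le t ht)) ha hab

theorem integral_nonneg (hy : IsSplitEnergy E r σ A B y) {t : ℝ} (ht : 0 ≤ t) :
    0 ≤ ∫ τ in (0 : ℝ)..t, y τ :=
  intervalIntegral.integral_nonneg ht fun τ hτ => hy.nonneg τ hτ.1

theorem integral_le_mul (hy : IsSplitEnergy E r σ A B y) {a b c : ℝ} (ha : 0 ≤ a) (hab : a ≤ b)
    (hc : ∀ t ∈ Icc a b, y t ≤ c) : ∫ τ in a..b, y τ ≤ c * (b - a) := by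
  have := intervalIntegral.integral_mono_on hab (hy.intervalIntegrable ha hab)
    (_root_.intervalIntegrable_const (c := c)) hc
  rwa [intervalIntegral.integral_const, smul_eq_mul, mul_comm] at this

theorem integral_le (hy : IsSplitEnergy E r σ A B y) {t : ℝ} (ht : 0 ≤ t) :
    ∫ τ in (0 : ℝ)..t, y τ ≤ E * (1 + t) := by
  have := hy.integral_le_mul le_rfl ht fun τ hτ => hy.le τ hτ.1
  linarith [hy.bound_nonneg]

theorem integral_le_rpow (hy : IsSplitEnergy E r σ A B y) {M ρ t : ℝ} (hM : 0 ≤ M)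
    (hρ : ρ ≤ 1 / 2) (ht : 0 ≤ t) (h : ∀ s ∈ Icc 0 t, y s ≤ M * (1 + s) ^ (-ρ)) :
    ∫ τ in (0 : ℝ)..t, y τ ≤ 2 * M * (1 + t) ^ (1 - ρ) := by
  have hd : ∀ s ∈ uIcc 0 t, HasDerivAt (fun s => 2 * M * (1 + s) ^ (1 - ρ))
      (2 * M * ((1 - ρ) * (1 + s) ^ (-ρ))) s := by
    intro s hs
    rw [uIcc_of_le ht] at hs
    simpa only [sub_sub_cancel_left] using
      (hasDerivAt_one_add_rpow (1 - ρ) hs.1).const_mul (2 * M)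
  have hi : IntervalIntegrable (fun s => 2 * M * ((1 - ρ) * (1 + s) ^ (-ρ))) volume 0 t := by
    refine ContinuousOn.intervalIntegrable ?_
    rw [uIcc_of_le ht]
    exact continuousOn_const.mul (continuousOn_const.mul (continuousOn_one_add_rpow (-ρ) t))
  calc ∫ τ in (0 : ℝ)..t, y τ
      ≤ ∫ s in (0 : ℝ)..t, 2 * M * ((1 - ρ) * (1 + s) ^ (-ρ)) := by
        refine intervalIntegral.integral_mono_on ht (hy.intervalIntegrable le_rfl ht) hi ?_
        intro s hs
        have : 0 ≤ M * (1 + s) ^ (-ρ) := mul_nonneg hM (Real.rpow_nonneg (by linarith [hs.1]) _)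
        nlinarith [h s hs]
    _ = 2 * M * (1 + t) ^ (1 - ρ) - 2 * M * (1 + 0) ^ (1 - ρ) :=
        intervalIntegral.integral_eq_sub_of_hasDerivAt hd hi
    _ ≤ 2 * M * (1 + t) ^ (1 - ρ) := sub_le_self _ (by positivity)

theorem le_add_rpow (hy : IsSplitEnergy E r σ A B y) {κ ρ P Q T : ℝ} (hκ : 0 < κ) (hρ : ρ ≤ κ)
    (hQ : 0 ≤ Q) (hT : 0 ≤ T) (hEQ : E ≤ P + Q)
    (hF : ∀ t ∈ Icc 0 T, lowFrequencyBound r σ (A κ) (B κ) y t ≤ P + Q / 2 * (1 + t) ^ (-ρ)) :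
    y T ≤ P + Q * (1 + T) ^ (-ρ) := by
  have hsub : Icc 0 T ⊆ Ici 0 := fun _ ht => ht.1
  have hpos : ∀ t ∈ Icc 0 T, 0 < 1 + t := fun t ht => by linarith [ht.1]
  refine le_supersolution_of_energy (h := fun t => 2 * (κ / (1 + t)))
    (z := fun t => P + Q * (1 + t) ^ (-ρ)) (z' := fun t => Q * (-ρ * (1 + t) ^ (-ρ - 1))) hT
    (fun t ht => ?_) (fun t ht => ?_)
    (continuousOn_lowFrequencyBound r σ (A κ) (B κ) hT (hy.intervalIntegrable le_rfl hT))
    (fun t ht => ((hasDerivAt_one_add_rpow (-ρ) ht.1).const_mul Q).const_add P)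
    (continuousOn_const.mul (continuousOn_const.mul (continuousOn_one_add_rpow _ T)))
    (fun t ht => ?_) (hy.intervalIntegrable le_rfl hT) ((hy.energy_zero κ hκ T hT).trans ?_) ?_
  · have := hpos t ht
    positivity
  · have := (hpos t ht).ne'
    fun_prop (disch := assumption)
  · have : 0 < 1 + t := hpos t ht
    have hz' : (1 + t) ^ (-ρ - 1) = (1 + t) ^ (-ρ) / (1 + t) := by
      rw [Real.rpow_sub this, Real.rpow_one]
    calc -(2 * (κ / (1 + t)) * (P + Q * (1 + t) ^ (-ρ) - lowFrequencyBound r σ (A κ) (B κ) y t))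
        = 2 * (κ / (1 + t)) * (lowFrequencyBound r σ (A κ) (B κ) y t - P - Q * (1 + t) ^ (-ρ)) := by
          ring
      _ ≤ 2 * (κ / (1 + t)) * (-(Q / 2 * (1 + t) ^ (-ρ))) := by
          gcongr
          linarith [hF t ht]
      _ = -(κ * (Q * ((1 + t) ^ (-ρ) / (1 + t)))) := by ring
      _ ≤ -(ρ * (Q * ((1 + t) ^ (-ρ) / (1 + t)))) := by gcongr
      _ = Q * (-ρ * (1 + t) ^ (-ρ - 1)) := by rw [hz']; ring
  · simpa only [add_zero, Real.one_rpow, mul_one] using hEQ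
  · filter_upwards [ae_mono (Measure.restrict_mono hsub le_rfl) (hy.energy κ hκ),
      ae_restrict_mem measurableSet_Icc] with s hs hsT
    exact hs T hsT.2

theorem le_rpow (hy : IsSplitEnergy E r σ A B y) {κ ρ Q T : ℝ} (hκ : 0 < κ) (hρ : ρ ≤ κ)
    (hT : 0 ≤ T) (hEQ : E ≤ Q)
    (hF : ∀ t ∈ Icc 0 T, lowFrequencyBound r σ (A κ) (B κ) y t ≤ Q / 2 * (1 + t) ^ (-ρ)) :
    y T ≤ Q * (1 + T) ^ (-ρ) := by
  simpa only [zero_add] using hy.le_add_rpow (P := 0) hκ hρ (hy.bound_nonneg.trans hEQ) hT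
    (by rwa [zero_add]) (by simpa only [zero_add] using hF)

end IsSplitEnergy

theorem lowFrequencyBound_le {a b q t X : ℝ} (hb : 0 ≤ b) (ht : 0 ≤ t)
    (hX : (∫ τ in (0 : ℝ)..t, y τ) ^ 2 ≤ X * (1 + t) ^ (1 + σ - q)) :
    lowFrequencyBound r σ a b y t ≤ a * (1 + t) ^ (-r) + b * X * (1 + t) ^ (-q) := by
  have : 0 < 1 + t := by positivity
  have hq : (1 + t) ^ (-q) = (1 + t) ^ (-(1 + σ)) * (1 + t) ^ (1 + σ - q) := by
    rw [← Real.rpow_add this]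
    congr 1
    ring
  calc lowFrequencyBound r σ a b y t
      ≤ a * (1 + t) ^ (-r) + b * (1 + t) ^ (-(1 + σ)) * (X * (1 + t) ^ (1 + σ - q)) := by
        unfold lowFrequencyBound; gcongr
    _ = _ := by rw [hq]; ring

namespace IsSplitEnergy

theorem exists_forall_le (hσ : 1 ≤ σ) (hr : 0 < r) (hA : ∀ κ, 0 < κ → 0 ≤ A κ)
    (hB : ∀ κ, 0 < κ → 0 ≤ B κ) (hB₀ : Filter.Tendsto B (nhdsWithin 0 (Ioi 0)) (nhds 0))
    (E : ℝ) {ε : ℝ} (hε : 0 < ε) :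
    ∃ T, 0 ≤ T ∧ ∀ y, IsSplitEnergy E r σ A B y → ∀ t, T ≤ t → y t ≤ ε := by
  -- As `∫ y ≤ E * (1 + t)`, the nonlinear term is at most `ε / 2` when `κ` is small.
  obtain ⟨κ, hκ, hBκ⟩ : ∃ κ, 0 < κ ∧ B κ * E ^ 2 ≤ ε / 2 := by
    have hlim : Filter.Tendsto (fun κ => B κ * E ^ 2) (nhdsWithin 0 (Ioi 0)) (nhds 0) := by
      simpa only [zero_mul] using hB₀.mul_const (E ^ 2)
    exact (eventually_mem_nhdsWithin.and (hlim.eventually_le_const (half_pos hε))).exists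
  set ρ := min r κ
  have hρ : 0 < ρ := lt_min hr hκ
  obtain ⟨T, hT⟩ : ∃ T, ∀ t, T ≤ t → (2 * A κ + E) * (1 + t) ^ (-ρ) ≤ ε / 2 := by
    have hlim : Filter.Tendsto (fun t : ℝ => (2 * A κ + E) * (1 + t) ^ (-ρ)) Filter.atTop
        (nhds 0) := by
      simpa only [Function.comp_def, id, mul_zero] using ((tendsto_rpow_neg_atTop hρ).comp
        (Filter.tendsto_atTop_add_const_left _ 1 Filter.tendsto_id)).const_mul (2 * A κ + E)
    exact Filter.eventually_atTop.1 (hlim.eventually_le_const (half_pos hε))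
  refine ⟨max T 0, le_max_right _ _, fun y hy t ht => ?_⟩
  obtain ⟨hTt, ht₀⟩ := max_le_iff.1 ht
  have hE := hy.bound_nonneg
  have := hA κ hκ
  have hdecay : y t ≤ ε / 2 + (2 * A κ + E) * (1 + t) ^ (-ρ) := by
    refine hy.le_add_rpow hκ (min_le_right r κ) (by positivity) ht₀ (by linarith) fun s hs => ?_
    have hs₀ : 0 ≤ s := hs.1
    have hY : (∫ τ in (0 : ℝ)..s, y τ) ^ 2 ≤ E ^ 2 * (1 + s) ^ (1 + σ - 0) :=
      calc (∫ τ in (0 : ℝ)..s, y τ) ^ 2 ≤ (E * (1 + s)) ^ 2 :=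
            pow_le_pow_left₀ (hy.integral_nonneg hs₀) (hy.integral_le hs₀) 2
        _ = E ^ 2 * (1 + s) ^ (2 : ℝ) := by rw [mul_pow, Real.rpow_two]
        _ ≤ E ^ 2 * (1 + s) ^ (1 + σ - 0) := by gcongr <;> linarith
    calc lowFrequencyBound r σ (A κ) (B κ) y s
        ≤ A κ * (1 + s) ^ (-r) + B κ * E ^ 2 * (1 + s) ^ (-0 : ℝ) :=
          lowFrequencyBound_le (hB κ hκ) hs₀ hY
      _ ≤ (2 * A κ + E) / 2 * (1 + s) ^ (-ρ) + ε / 2 * (1 + s) ^ (-0 : ℝ) := by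
          gcongr
          · linarith
          · linarith
          · exact min_le_left r κ
      _ = ε / 2 + (2 * A κ + E) / 2 * (1 + s) ^ (-ρ) := by rw [neg_zero, Real.rpow_zero]; ring
  linarith [hT t hTt]

theorem exists_integral_le (hσ : 1 ≤ σ) (hr : 0 < r) (hA : ∀ κ, 0 < κ → 0 ≤ A κ)
    (hB : ∀ κ, 0 < κ → 0 ≤ B κ) (hB₀ : Filter.Tendsto B (nhdsWithin 0 (Ioi 0)) (nhds 0))
    (hE : 0 ≤ E) {ε : ℝ} (hε : 0 < ε) :
    ∃ C, 0 ≤ C ∧ ∀ y, IsSplitEnergy E r σ A B y →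
      ∀ t, 0 ≤ t → ∫ τ in (0 : ℝ)..t, y τ ≤ C + ε * t := by
  obtain ⟨T, hT, hyT⟩ := exists_forall_le hσ hr hA hB hB₀ E hε
  refine ⟨E * T, by positivity, fun y hy t ht => ?_⟩
  have hsmall : ∀ s, 0 ≤ s → s ≤ T → ∫ τ in (0 : ℝ)..s, y τ ≤ E * T := fun s hs hsT =>
    (hy.integral_le_mul le_rfl hs fun τ hτ => hy.le τ hτ.1).trans (by gcongr; linarith)
  rcases le_total t T with htT | hTt
  · linarith [hsmall t ht htT, mul_nonneg hε.le ht]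
  · rw [← intervalIntegral.integral_add_adjacent_intervals (hy.intervalIntegrable le_rfl hT)
      (hy.intervalIntegrable hT hTt)]
    have hlarge := hy.integral_le_mul hT hTt fun τ hτ => hyT y hy τ hτ.1
    linarith [hsmall T hT le_rfl, mul_nonneg hε.le hT]

theorem sq_integral_le (hy : IsSplitEnergy E r σ A B y) {C M ε ρ t : ℝ} (hC : 0 ≤ C)
    (hM : 0 ≤ M) (hε : 0 ≤ ε) (hρ : ρ ≤ 1 / 2) (ht : 0 ≤ t)
    (hlin : ∫ τ in (0 : ℝ)..t, y τ ≤ C + ε * t)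
    (hdecay : ∀ s ∈ Icc 0 t, y s ≤ M * (1 + s) ^ (-ρ)) :
    (∫ τ in (0 : ℝ)..t, y τ) ^ 2 ≤ (C * E + 2 * ε * M) * (1 + t) ^ (2 - ρ) := by
  have := hy.bound_nonneg
  have ht' : 1 ≤ 1 + t := by linarith
  have hpow : (1 + t) ^ (2 - ρ) = (1 + t) * (1 + t) ^ (1 - ρ) := by
    rw [show 2 - ρ = 1 + (1 - ρ) by ring, Real.rpow_add (by linarith), Real.rpow_one]
  have hone : 1 ≤ (1 + t) ^ (1 - ρ) := Real.one_le_rpow ht' (by linarith)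
  have hY := hy.integral_nonneg ht
  set Y := ∫ τ in (0 : ℝ)..t, y τ
  calc Y ^ 2 ≤ (C + ε * t) * Y := by rw [sq]; gcongr
    _ = C * Y + ε * t * Y := by ring
    _ ≤ C * (E * (1 + t)) + ε * (1 + t) * (2 * M * (1 + t) ^ (1 - ρ)) := by
        gcongr
        exacts [hy.integral_le ht, by linarith, hy.integral_le_rpow hM hρ ht hdecay]
    _ ≤ C * (E * (1 + t)) * (1 + t) ^ (1 - ρ) + ε * (1 + t) * (2 * M * (1 + t) ^ (1 - ρ)) := by
        gcongr ?_ + _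
        exact le_mul_of_one_le_right (by positivity) hone
    _ = (C * E + 2 * ε * M) * (1 + t) ^ (2 - ρ) := by rw [hpow]; ring

theorem exists_slow_decay (hσ : 1 ≤ σ) (hr : 0 < r) (hA : ∀ κ, 0 < κ → 0 ≤ A κ)
    (hB : ∀ κ, 0 < κ → 0 ≤ B κ) (hB₀ : Filter.Tendsto B (nhdsWithin 0 (Ioi 0)) (nhds 0))
    (hE : 0 ≤ E) :
    ∃ M, 0 ≤ M ∧ ∀ y, IsSplitEnergy E r σ A B y →
      ∀ t, 0 ≤ t → y t ≤ M * (1 + t) ^ (-(min r (1 / 2))) := by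
  set ρ := min r (1 / 2)
  have hρ : ρ ≤ 1 / 2 := min_le_right _ _
  have ha := hA 1 one_pos
  have hb := hB 1 one_pos
  -- One factor of `(∫ y) ^ 2` is at most `C + ε * t`, so the nonlinear term can be absorbed.
  set ε := 1 / (8 * (B 1 + 1)) with hε_def
  have hε : 0 < ε := by positivity
  have hbε : B 1 * ε ≤ 1 / 8 := by
    rw [hε_def, mul_one_div, div_le_div_iff₀ (by positivity) (by norm_num)]
    linarith
  obtain ⟨C, hC, hCy⟩ := exists_integral_le hσ hr hA hB hB₀ hE hε
  set D := A 1 + B 1 * (C * E)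
  have hD : 0 ≤ D := by positivity
  refine ⟨2 * (E + 2 * D), by positivity, fun y hy T hT => ?_⟩
  refine le_two_mul_of_absorb (s := Icc 0 T) (g := fun t => (1 + t) ^ (-ρ))
    (fun t ht => Real.rpow_pos_of_pos (by linarith [ht.1]) _) ?_ (fun M hM t ht => ?_)
    T ⟨hT, le_rfl⟩
  · refine ⟨E * (1 + T) ^ ρ, fun t ht => (hy.le t ht.1).trans ?_⟩
    have : 0 < 1 + t := by linarith [ht.1]
    rw [Real.rpow_neg this.le, mul_assoc, ← div_eq_mul_inv]
    refine le_mul_of_one_le_right hE ((one_le_div (Real.rpow_pos_of_pos this _)).2 ?_)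
    have : 0 ≤ ρ := (lt_min hr (by norm_num)).le
    gcongr
    exact ht.2
  · have hM₀ : 0 ≤ M := by
      simpa only [add_zero, Real.one_rpow, mul_one] using
        (hy.nonneg 0 le_rfl).trans (hM 0 ⟨le_rfl, hT⟩)
    refine hy.le_rpow one_pos (by linarith) ht.1 (by linarith) fun s hs => ?_
    have hs₀ : 0 ≤ s := hs.1
    have hY := hy.sq_integral_le hC hM₀ hε.le hρ hs₀ (hCy y hy s hs₀)
      fun τ hτ => hM τ ⟨hτ.1, hτ.2.trans (hs.2.trans ht.2)⟩
    calc lowFrequencyBound r σ (A 1) (B 1) y s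
        ≤ A 1 * (1 + s) ^ (-r) + B 1 * (C * E + 2 * ε * M) * (1 + s) ^ (-ρ) := by
          refine lowFrequencyBound_le hb hs₀ (hY.trans ?_)
          gcongr <;> linarith
      _ ≤ A 1 * (1 + s) ^ (-ρ) + B 1 * (C * E + 2 * ε * M) * (1 + s) ^ (-ρ) := by
          gcongr
          · linarith
          · exact min_le_left _ _
      _ = (D + 2 * (B 1 * ε) * M) * (1 + s) ^ (-ρ) := by ring
      _ ≤ (E + 2 * D + M / 2) / 2 * (1 + s) ^ (-ρ) := by
          gcongr
          nlinarith

theorem exists_decay (hσ : 1 ≤ σ) (hr : 0 < r) (hrσ : r ≤ σ) (hA : ∀ κ, 0 < κ → 0 ≤ A κ)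
    (hB : ∀ κ, 0 < κ → 0 ≤ B κ) (hB₀ : Filter.Tendsto B (nhdsWithin 0 (Ioi 0)) (nhds 0))
    (hE : 0 ≤ E) :
    ∃ C, ∀ y, IsSplitEnergy E r σ A B y → ∀ t, 0 ≤ t → y t ≤ C * (1 + t) ^ (-r) := by
  obtain ⟨M, hM, hMy⟩ := exists_slow_decay hσ hr hA hB hB₀ hE
  have ha := hA r hr
  have hb := hB r hr
  set ρ := min r (1 / 2) with hρ
  have hρr : r ≤ σ - 1 + 2 * ρ := by
    rcases min_choice r (1 / 2) with h | h <;> rw [hρ, h] <;> linarith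
  set D := A r + B r * (4 * M ^ 2)
  have hD : 0 ≤ D := by positivity
  refine ⟨E + 2 * D, fun y hy T hT => ?_⟩
  refine hy.le_rpow hr le_rfl hT (by linarith) fun s hs => ?_
  have hs₀ : 0 ≤ s := hs.1
  have hY : (∫ τ in (0 : ℝ)..s, y τ) ^ 2 ≤ 4 * M ^ 2 * (1 + s) ^ (1 + σ - r) :=
    calc (∫ τ in (0 : ℝ)..s, y τ) ^ 2 ≤ (2 * M * (1 + s) ^ (1 - ρ)) ^ 2 :=
          pow_le_pow_left₀ (hy.integral_nonneg hs₀) (hy.integral_le_rpow hM (min_le_right _ _) hs₀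
            fun τ hτ => hMy y hy τ hτ.1) 2
      _ = 4 * M ^ 2 * (1 + s) ^ (2 * (1 - ρ)) := by
          rw [mul_pow, ← Real.rpow_mul_natCast (by positivity), Nat.cast_ofNat, mul_comm 2 (1 - ρ)]
          ring
      _ ≤ 4 * M ^ 2 * (1 + s) ^ (1 + σ - r) := by gcongr <;> linarith
  calc lowFrequencyBound r σ (A r) (B r) y s
      ≤ A r * (1 + s) ^ (-r) + B r * (4 * M ^ 2) * (1 + s) ^ (-r) :=
        lowFrequencyBound_le hb hs₀ hY
    _ = D * (1 + s) ^ (-r) := by ring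
    _ ≤ (E + 2 * D) / 2 * (1 + s) ^ (-r) := by
        gcongr
        linarith

end IsSplitEnergy

end SplitEnergy

/-! ### Low-frequency estimates -/

section L2

theorem norm_le_of_forall_norm_inner_le {𝕜 H ι : Type*} [RCLike 𝕜] [NormedAddCommGroup H]
    [InnerProductSpace 𝕜 H] {e : ι → H} (he : DenseRange e) {x : H} {B : ℝ} (hB : 0 ≤ B)
    (h : ∀ i, ‖inner 𝕜 x (e i)‖ ≤ B * ‖e i‖) : ‖x‖ ≤ B := by
  rw [← innerSL_apply_norm (𝕜 := 𝕜) x]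
  refine ContinuousLinearMap.opNorm_le_bound _ hB fun y => ?_
  simp only [innerSL_apply_apply]
  exact he.induction_on y (isClosed_le (by fun_prop) (by fun_prop)) h

variable {X F G H : Type*} [MeasurableSpace X] {μ : Measure X} [NormedAddCommGroup F]
  [NormedAddCommGroup G] [NormedAddCommGroup H]

theorem enorm_sq_eq_lintegral (f : Lp F 2 μ) : ‖f‖ₑ ^ 2 = ∫⁻ x, ‖f x‖ₑ ^ 2 ∂μ := by
  rw [Lp.enorm_def]
  simpa using eLpNorm_nnreal_pow_eq_lintegral (f := f) (μ := μ) (p := 2) two_ne_zero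

theorem norm_integral_le_of_norm_le_mul_norm_mul_norm [NormedSpace ℝ H] {h : X → H} {c : ℝ}
    (hc : 0 ≤ c) (f : Lp F 2 μ) (g : Lp G 2 μ)
    (hh : ∀ᵐ x ∂μ, ‖h x‖ ≤ c * (‖f x‖ * ‖g x‖)) : ‖∫ x, h x ∂μ‖ ≤ c * (‖f‖ * ‖g‖) := by
  have hf := (Lp.memLp f).norm
  have hg := (Lp.memLp g).norm
  have hfg : ∫ x, ‖f x‖ * ‖g x‖ ∂μ = inner ℝ (hf.toLp _) (hg.toLp _) := by
    rw [L2.inner_def]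
    refine integral_congr_ae ?_
    filter_upwards [hf.coeFn_toLp, hg.coeFn_toLp] with x hfx hgx
    rw [hfx, hgx, RCLike.inner_apply, conj_trivial, mul_comm]
  calc ‖∫ x, h x ∂μ‖ ≤ ∫ x, c * (‖f x‖ * ‖g x‖) ∂μ :=
        norm_integral_le_of_norm_le ((hf.integrable_mul hg).const_mul c) hh
    _ = c * inner ℝ (hf.toLp _) (hg.toLp _) := by rw [integral_const_mul, hfg]
    _ ≤ c * (‖hf.toLp _‖ * ‖hg.toLp _‖) := by gcongr; exact real_inner_le_norm _ _
    _ = c * (‖f‖ * ‖g‖) := by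
        rw [Lp.norm_toLp, Lp.norm_toLp, eLpNorm_norm, eLpNorm_norm, ← Lp.norm_def, ← Lp.norm_def]

theorem lintegral_enorm_mul_enorm_le {f : X → F} {g : X → G} {p : ℝ} {S : ℝ≥0∞} (hp : 1 ≤ p)
    (hp₂ : p ≤ 2) (hf : AEStronglyMeasurable f μ) (hg : AEStronglyMeasurable g μ)
    (hS : ∀ᵐ x ∂μ, ‖g x‖ₑ ≤ S) :
    ∫⁻ x, ‖f x‖ₑ * ‖g x‖ₑ ∂μ ≤
      S ^ (2 / p - 1) * (eLpNorm f (.ofReal p) μ * eLpNorm g 2 μ ^ (2 - 2 / p)) := by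
  have hp₀ : 0 < p := by linarith
  have h₁ : 0 ≤ 2 / p - 1 := by rw [sub_nonneg, one_le_div hp₀]; exact hp₂
  have h₂ : 0 ≤ 1 - 1 / p := by rw [sub_nonneg, div_le_one hp₀]; exact hp
  have hsplit : ∀ᵐ x ∂μ, ‖f x‖ₑ * ‖g x‖ₑ ≤
      S ^ (2 / p - 1) * ((‖f x‖ₑ ^ p) ^ (1 / p) * (‖g x‖ₑ ^ (2 : ℝ)) ^ (1 - 1 / p)) := by
    filter_upwards [hS] with x hx
    calc ‖f x‖ₑ * ‖g x‖ₑ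
        = ‖f x‖ₑ * (‖g x‖ₑ ^ (2 / p - 1) * ‖g x‖ₑ ^ (2 * (1 - 1 / p))) := by
          rw [← ENNReal.rpow_add_of_nonneg _ _ h₁ (by positivity),
            show 2 / p - 1 + 2 * (1 - 1 / p) = 1 by ring, ENNReal.rpow_one]
      _ ≤ ‖f x‖ₑ * (S ^ (2 / p - 1) * ‖g x‖ₑ ^ (2 * (1 - 1 / p))) := by gcongr
      _ = _ := by
          rw [← ENNReal.rpow_mul, ← ENNReal.rpow_mul, mul_one_div_cancel hp₀.ne', ENNReal.rpow_one]
          ring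
  refine (lintegral_mono_ae hsplit).trans ?_
  rw [lintegral_const_mul'' _ (by fun_prop)]
  gcongr
  refine (ENNReal.lintegral_mul_norm_pow_le (by fun_prop) (by fun_prop) (by positivity) h₂
    (by ring)).trans_eq ?_
  rw [eLpNorm_eq_lintegral_rpow_enorm_toReal (by simpa using hp₀) ENNReal.ofReal_ne_top,
    eLpNorm_eq_lintegral_rpow_enorm_toReal two_ne_zero ENNReal.ofNat_ne_top,
    ENNReal.toReal_ofReal hp₀.le, ENNReal.toReal_ofNat, ← ENNReal.rpow_mul]
  congr 2
  ring

theorem enorm_inner_le_of_ae_enorm_le_mul {𝕜 : Type*} [RCLike 𝕜] [InnerProductSpace 𝕜 F]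
    {f g : Lp F 2 μ} {p : ℝ} {a b : ℝ≥0∞} (hp : 1 ≤ p) (hp₂ : p ≤ 2)
    (hab : ∀ᵐ x ∂μ, ‖g x‖ₑ ≤ a * b) (hb : ‖g‖ₑ ≤ b) :
    ‖inner 𝕜 f g‖ₑ ≤ a ^ (2 / p - 1) * eLpNorm f (.ofReal p) μ * b := by
  have h₁ : 0 ≤ 2 / p - 1 := by rw [sub_nonneg, one_le_div (by linarith)]; exact hp₂
  have h₂ : 0 ≤ 2 - 2 / p := by rw [sub_nonneg, div_le_iff₀ (by linarith)]; linarith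
  calc ‖inner 𝕜 f g‖ₑ ≤ ∫⁻ x, ‖f x‖ₑ * ‖g x‖ₑ ∂μ := by
        rw [L2.inner_def]
        refine (enorm_integral_le_lintegral_enorm _).trans (lintegral_mono fun x => ?_)
        simp only [enorm_eq_nnnorm]
        exact_mod_cast nnnorm_inner_le_nnnorm (f x) (g x)
    _ ≤ (a * b) ^ (2 / p - 1) * (eLpNorm f (.ofReal p) μ * eLpNorm g 2 μ ^ (2 - 2 / p)) :=
      lintegral_enorm_mul_enorm_le hp hp₂ (Lp.aestronglyMeasurable f)
        (Lp.aestronglyMeasurable g) hab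
    _ ≤ (a * b) ^ (2 / p - 1) * (eLpNorm f (.ofReal p) μ * b ^ (2 - 2 / p)) := by
      rw [← Lp.enorm_def]
      gcongr
    _ = a ^ (2 / p - 1) * eLpNorm f (.ofReal p) μ * b ^ (2 / p - 1 + (2 - 2 / p)) := by
      rw [ENNReal.mul_rpow_of_nonneg _ _ h₁, ENNReal.rpow_add_of_nonneg _ _ h₁ h₂]
      ring
    _ = _ := by rw [show 2 / p - 1 + (2 - 2 / p) = 1 by ring, ENNReal.rpow_one]

end L2

section Cutoff

variable {V : Type*} [NormedAddCommGroup V] [InnerProductSpace ℝ V]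

/-- The pointwise product of a real and a complex Schwartz function. -/
noncomputable def schwartzMul (η : 𝓢(V, ℝ)) (ψ : 𝓢(V, ℂ)) : 𝓢(V, ℂ) :=
  SchwartzMap.smulLeftCLM ℂ η ψ

theorem schwartzMul_apply (η : 𝓢(V, ℝ)) (ψ : 𝓢(V, ℂ)) (ξ : V) :
    schwartzMul η ψ ξ = η ξ • ψ ξ :=
  SchwartzMap.smulLeftCLM_apply_apply η.hasTemperateGrowth ψ ξ

variable [FiniteDimensional ℝ V] [MeasurableSpace V] [BorelSpace V]

theorem norm_fourierInv_le_integral (χ : 𝓢(V, ℂ)) (x : V) :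
    ‖(𝓕⁻ χ : 𝓢(V, ℂ)) x‖ ≤ ∫ ξ, ‖χ ξ‖ := by
  rw [SchwartzMap.fourierInv_coe, Real.fourierInv_eq]
  refine (norm_integral_le_integral_norm _).trans_eq ?_
  simp only [Circle.norm_smul]

theorem norm_fderiv_fourierInv_le (χ : 𝓢(V, ℂ)) (x v : V) {b : ℝ}
    (hb : ∀ ξ, χ ξ ≠ 0 → |inner ℝ ξ v| ≤ b) :
    ‖fderiv ℝ (𝓕⁻ χ : 𝓢(V, ℂ)) x v‖ ≤ 2 * Real.pi * b * ∫ ξ, ‖χ ξ‖ := by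
  have hv : (fun ξ : V => inner ℝ ξ v).HasTemperateGrowth := by fun_prop
  rw [← SchwartzMap.lineDerivOp_apply_eq_fderiv, SchwartzMap.lineDerivOp_fourierInv_eq]
  refine (norm_fourierInv_le_integral _ x).trans ?_
  rw [← integral_const_mul]
  refine integral_mono_of_nonneg (.of_forall fun ξ => norm_nonneg _)
    (χ.integrable.norm.const_mul _) (.of_forall fun ξ => ?_)
  simp only [smul_apply, SchwartzMap.smulLeftCLM_apply_apply hv, norm_smul, norm_mul,
    Complex.norm_ofNat, Complex.norm_real, Complex.norm_I, mul_one, Real.norm_eq_abs,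
    abs_of_pos Real.pi_pos, mul_assoc]
  by_cases h₀ : χ ξ = 0
  · simp only [h₀, norm_zero, mul_zero, le_refl]
  · gcongr
    exact hb ξ h₀

theorem integral_norm_schwartzMul_le (η : 𝓢(V, ℝ)) (ψ : 𝓢(V, ℂ)) :
    ∫ ξ, ‖schwartzMul η ψ ξ‖ ≤ ‖η.toLp 2‖ * ‖ψ.toLp 2‖ := by
  have h := norm_integral_le_of_norm_le_mul_norm_mul_norm (h := fun ξ => ‖schwartzMul η ψ ξ‖)
    zero_le_one (η.toLp 2) (ψ.toLp 2) (by
      filter_upwards [η.coeFn_toLp 2, ψ.coeFn_toLp 2] with ξ hη hψ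
      rw [hη, hψ, norm_norm, schwartzMul_apply, norm_smul, one_mul])
  rwa [one_mul, Real.norm_of_nonneg (integral_nonneg fun ξ => norm_nonneg _)] at h

/-- Multiplication by a Schwartz function, as an operator on `L²`. -/
noncomputable def cutoff (η : 𝓢(V, ℝ)) :
    Lp ℂ 2 (volume : Measure V) →L[ℝ] Lp ℂ 2 (volume : Measure V) :=
  (ContinuousLinearMap.lsmul ℝ ℝ).holderL volume ∞ 2 2 (η.toLp ∞)

theorem coeFn_cutoff (η : 𝓢(V, ℝ)) (f : Lp ℂ 2 (volume : Measure V)) :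
    cutoff η f =ᵐ[volume] fun ξ => η ξ • f ξ := by
  have hf : cutoff η f = (ContinuousLinearMap.lsmul ℝ ℝ).holder 2 (η.toLp ∞ volume) f := rfl
  rw [hf]
  filter_upwards [(ContinuousLinearMap.lsmul ℝ ℝ).coeFn_holder (r := 2) (η.toLp ∞ volume) f,
    η.coeFn_toLp ∞ volume] with ξ hξ hη
  rw [hξ, hη, ContinuousLinearMap.lsmul_apply]

theorem cutoff_toLp (η : 𝓢(V, ℝ)) (ψ : 𝓢(V, ℂ)) :
    cutoff η (ψ.toLp 2) = (schwartzMul η ψ).toLp 2 := by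
  refine Lp.ext ?_
  filter_upwards [coeFn_cutoff η (ψ.toLp 2), ψ.coeFn_toLp 2, (schwartzMul η ψ).coeFn_toLp 2]
    with ξ hη hψ hηψ
  rw [hη, hψ, hηψ, schwartzMul_apply]

theorem inner_cutoff_left (η : 𝓢(V, ℝ)) (f g : Lp ℂ 2 (volume : Measure V)) :
    inner ℂ (cutoff η f) g = inner ℂ f (cutoff η g) := by
  rw [L2.inner_def, L2.inner_def]
  refine integral_congr_ae ?_
  filter_upwards [coeFn_cutoff η f, coeFn_cutoff η g] with ξ hf hg
  rw [hf, hg, inner_smul_left_eq_smul, inner_smul_right_eq_smul]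

theorem norm_cutoff_le {η : 𝓢(V, ℝ)} (hη : ∀ ξ, |η ξ| ≤ 1) (f : Lp ℂ 2 (volume : Measure V)) :
    ‖cutoff η f‖ ≤ ‖f‖ := by
  refine Lp.norm_le_norm_of_ae_le ?_
  filter_upwards [coeFn_cutoff η f] with ξ hξ
  rw [hξ, norm_smul]
  exact mul_le_of_le_one_left (norm_nonneg _) (hη ξ)

theorem inner_cutoff_fourier (η : 𝓢(V, ℝ)) (f : Lp ℂ 2 (volume : Measure V)) (ψ : 𝓢(V, ℂ)) :
    inner ℂ (cutoff η (𝓕 f)) (ψ.toLp 2) = inner ℂ f ((𝓕⁻ (schwartzMul η ψ)).toLp 2) := by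
  rw [inner_cutoff_left, cutoff_toLp, ← Lp.inner_fourier_eq f, SchwartzMap.toLp_fourier_eq,
    FourierTransform.fourier_fourierInv_eq]

theorem norm_fourierInv_schwartzMul_le (η : 𝓢(V, ℝ)) (ψ : 𝓢(V, ℂ)) (x : V) :
    ‖(𝓕⁻ (schwartzMul η ψ) : 𝓢(V, ℂ)) x‖ ≤ ‖η.toLp 2‖ * ‖ψ.toLp 2‖ :=
  (norm_fourierInv_le_integral _ x).trans (integral_norm_schwartzMul_le η ψ)

theorem norm_toLp_fourierInv_schwartzMul_le {η : 𝓢(V, ℝ)} (hη : ∀ ξ, |η ξ| ≤ 1) (ψ : 𝓢(V, ℂ)) :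
    ‖(𝓕⁻ (schwartzMul η ψ)).toLp 2‖ ≤ ‖ψ.toLp 2‖ := by
  rw [← Lp.norm_fourier_eq, SchwartzMap.toLp_fourier_eq, FourierTransform.fourier_fourierInv_eq,
    ← cutoff_toLp]
  exact norm_cutoff_le hη _

theorem norm_cutoff_fourier_le_of_forall {η : 𝓢(V, ℝ)} {f : Lp ℂ 2 (volume : Measure V)} {B : ℝ}
    (hB : 0 ≤ B) (h : ∀ ψ : 𝓢(V, ℂ),
      ‖inner ℂ f ((𝓕⁻ (schwartzMul η ψ)).toLp 2)‖ ≤ B * ‖ψ.toLp 2‖) :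
    ‖cutoff η (𝓕 f)‖ ≤ B :=
  norm_le_of_forall_norm_inner_le (𝕜 := ℂ)
    (SchwartzMap.denseRange_toLpCLM (E := V) (F := ℂ) (p := 2) (μ := volume)
      ENNReal.ofNat_ne_top) hB
    fun ψ => by simpa only [SchwartzMap.toLpCLM_apply, inner_cutoff_fourier] using h ψ

theorem norm_cutoff_fourier_le_of_memLp {η : 𝓢(V, ℝ)} (hη : ∀ ξ, |η ξ| ≤ 1) {p : ℝ} (hp : 1 ≤ p)
    (hp₂ : p ≤ 2) {f : Lp ℂ 2 (volume : Measure V)} (hf : MemLp f (.ofReal p)) :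
    ‖cutoff η (𝓕 f)‖ ≤ ‖η.toLp 2‖ ^ (2 / p - 1) * (eLpNorm f (.ofReal p)).toReal := by
  have h₁ : 0 ≤ 2 / p - 1 := by rw [sub_nonneg, one_le_div (by linarith)]; exact hp₂
  refine norm_cutoff_fourier_le_of_forall (by positivity) fun ψ => ?_
  have hsup : ∀ᵐ x, ‖(𝓕⁻ (schwartzMul η ψ)).toLp 2 volume x‖ₑ ≤
      ‖η.toLp 2 volume‖ₑ * ‖ψ.toLp 2 volume‖ₑ := by
    filter_upwards [(𝓕⁻ (schwartzMul η ψ)).coeFn_toLp 2 volume] with x hx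
    rw [hx, ← ofReal_norm, ← ofReal_norm, ← ofReal_norm, ← ENNReal.ofReal_mul (norm_nonneg _)]
    exact ENNReal.ofReal_le_ofReal (norm_fourierInv_schwartzMul_le η ψ x)
  have h := ENNReal.toReal_mono (ENNReal.mul_ne_top (ENNReal.mul_ne_top
      (ENNReal.rpow_ne_top_of_nonneg h₁ enorm_ne_top) hf.2.ne) enorm_ne_top)
    (enorm_inner_le_of_ae_enorm_le_mul (𝕜 := ℂ) (f := f) hp hp₂ hsup
      (enorm_le_iff_norm_le.2 (norm_toLp_fourierInv_schwartzMul_le hη ψ)))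
  simpa only [ENNReal.toReal_mul, ← ENNReal.toReal_rpow, toReal_enorm] using h

end Cutoff

section Gronwall

variable {f : ℝ → ℝ} {A c T : ℝ}

theorem mul_integral_le_of_le_mul_exp {M : ℝ} (hT : 0 ≤ T) (hc : 0 < c) (hM : 0 ≤ M)
    (hf : IntervalIntegrable f volume 0 T)
    (h : ∀ t ∈ Icc 0 T, f t ≤ M * Real.exp (2 * c * t)) :
    c * ∫ s in (0 : ℝ)..T, f s ≤ M / 2 * Real.exp (2 * c * T) := by
  have hcont : Continuous fun s => M * Real.exp (2 * c * s) := by fun_prop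
  have hderiv (s : ℝ) : HasDerivAt (fun s => M / (2 * c) * Real.exp (2 * c * s))
      (M * Real.exp (2 * c * s)) s := by
    refine ((((hasDerivAt_id s).const_mul (2 * c)).exp).const_mul (M / (2 * c))).congr_deriv ?_
    simp only [id]
    field_simp
  calc c * ∫ s in (0 : ℝ)..T, f s ≤ c * ∫ s in (0 : ℝ)..T, M * Real.exp (2 * c * s) := by
        gcongr
        exact intervalIntegral.integral_mono_on hT hf (hcont.intervalIntegrable _ _) h
    _ = c * (M / (2 * c) * Real.exp (2 * c * T) - M / (2 * c) * Real.exp (2 * c * 0)) := by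
        rw [intervalIntegral.integral_eq_sub_of_hasDerivAt (fun s _ => hderiv s)
          (hcont.intervalIntegrable _ _)]
    _ ≤ c * (M / (2 * c) * Real.exp (2 * c * T)) := by
        gcongr
        exact sub_le_self _ (by positivity)
    _ = M / 2 * Real.exp (2 * c * T) := by field_simp

theorem le_mul_exp_of_le_add_integral {E : ℝ} (hT : 0 ≤ T) (hA : 0 ≤ A) (hc : 0 < c)
    (hf : IntervalIntegrable f volume 0 T) (hf₀ : ∀ t ∈ Icc 0 T, 0 ≤ f t)
    (hE : ∀ t ∈ Icc 0 T, f t ≤ E)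
    (h : ∀ t ∈ Icc 0 T, f t ≤ A + c * ∫ s in (0 : ℝ)..t, f s) :
    f T ≤ 2 * A * Real.exp (2 * c * T) := by
  have hone : ∀ t ∈ Icc 0 T, 1 ≤ Real.exp (2 * c * t) := fun t ht =>
    Real.one_le_exp (mul_nonneg (by positivity) ht.1)
  have hzero : (0 : ℝ) ∈ Icc 0 T := ⟨le_rfl, hT⟩
  refine le_two_mul_of_absorb (s := Icc 0 T) (g := fun t => Real.exp (2 * c * t)) (C := A)
    (fun t _ => Real.exp_pos _) ⟨E, fun t ht => (hE t ht).trans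
      (le_mul_of_one_le_right ((hf₀ 0 hzero).trans (hE 0 hzero)) (hone t ht))⟩
    (fun M hM t ht => ?_) T ⟨hT, le_rfl⟩
  have hM₀ : 0 ≤ M := nonneg_of_mul_nonneg_left ((hf₀ 0 hzero).trans (hM 0 hzero)) (Real.exp_pos _)
  have hsub : uIcc 0 t ⊆ uIcc 0 T := by
    rw [uIcc_of_le ht.1, uIcc_of_le hT]
    exact Icc_subset_Icc_right ht.2
  calc f t ≤ A + c * ∫ s in (0 : ℝ)..t, f s := h t ht
    _ ≤ A * Real.exp (2 * c * t) + M / 2 * Real.exp (2 * c * t) :=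
      add_le_add (le_mul_of_one_le_right hA (hone t ht)) <|
        mul_integral_le_of_le_mul_exp ht.1 hc hM₀ (hf.mono_set hsub)
          fun s hs => hM s ⟨hs.1, hs.2.trans ht.2⟩
    _ = (A + M / 2) * Real.exp (2 * c * t) := by ring

end Gronwall

theorem coeFn_toComplex (f : L2R) : toComplex f =ᵐ[volume] fun x => (f x : ℂ) :=
  Complex.ofRealCLM.coeFn_compLp f

theorem eLpNorm_toComplex (f : L2R) (p : ℝ≥0∞) : eLpNorm (toComplex f) p = eLpNorm f p := by
  refine eLpNorm_congr_norm_ae ?_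
  filter_upwards [coeFn_toComplex f] with x hx
  rw [hx, Complex.norm_real]

theorem norm_toComplex (f : L2R) : ‖toComplex f‖ = ‖f‖ := by
  rw [Lp.norm_def, Lp.norm_def, eLpNorm_toComplex]

theorem continuous_toComplex : Continuous toComplex :=
  (Complex.ofRealCLM.compLpL 2 (volume : Measure Plane)).continuous

theorem pairing_eq_inner (f : L2R) (g : L2C) : pairing f g = inner ℂ (toComplex f) g := by
  rw [L2.inner_def]
  refine integral_congr_ae ?_
  filter_upwards [coeFn_toComplex f] with x hx
  rw [hx, RCLike.inner_apply, Complex.conj_ofReal, mul_comm]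

theorem pairing_fourierInv (f : L2R) (g : L2C) :
    pairing f (𝓕⁻ g) = inner ℂ (𝓕 (toComplex f)) g := by
  rw [pairing_eq_inner, ← Lp.inner_fourier_eq, FourierTransform.fourier_fourierInv_eq]

theorem norm_multiplier_le {s : Plane → ℂ} (hs : ∀ ξ, ‖s ξ‖ ≤ 1) (f : L2C) :
    ‖multiplier s f‖ ≤ ‖f‖ := by
  unfold multiplier
  split_ifs with h
  · rw [← Lp.norm_fourier_eq, FourierTransform.fourier_fourierInv_eq, ← Lp.norm_fourier_eq f]
    refine Lp.norm_le_norm_of_ae_le ?_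
    filter_upwards [h.coeFn_toLp] with ξ hξ
    rw [hξ, norm_mul]
    exact mul_le_of_le_one_left (norm_nonneg _) (hs ξ)
  · rw [norm_zero]
    exact norm_nonneg _

theorem norm_velocitySymbol_le_one (j : Fin 2) (ξ : Plane) : ‖velocitySymbol j ξ‖ ≤ 1 := by
  have h (i : Fin 2) : |ξ i| / ‖ξ‖ ≤ 1 :=
    div_le_one_of_le₀ (PiLp.norm_apply_le ξ i) (norm_nonneg _)
  unfold velocitySymbol
  split_ifs
  · simpa using h 1
  · simpa using h 0

theorem norm_velocity_le (f : L2R) (j : Fin 2) : ‖velocity f j‖ ≤ ‖f‖ :=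
  (norm_multiplier_le (norm_velocitySymbol_le_one j) _).trans_eq (norm_toComplex f)

theorem norm_transport_le (f : L2R) {φ : 𝓢(Plane, ℂ)} {S : ℝ}
    (hφ : ∀ x (j : Fin 2), ‖fderiv ℝ φ x (EuclideanSpace.single j 1)‖ ≤ S) :
    ‖transport f φ‖ ≤ 2 * S * ‖f‖ ^ 2 := by
  have hS : 0 ≤ S := (norm_nonneg _).trans (hφ 0 0)
  have hj (j : Fin 2) : ‖∫ x, toComplex f x * velocity f j x *
      fderiv ℝ φ x (EuclideanSpace.single j 1)‖ ≤ S * (‖f‖ * ‖f‖) := by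
    refine (norm_integral_le_of_norm_le_mul_norm_mul_norm hS (toComplex f) (velocity f j)
      (.of_forall fun x => ?_)).trans ?_
    · rw [norm_mul, norm_mul, mul_comm]
      gcongr
      exact hφ x j
    · rw [norm_toComplex]
      gcongr
      exact norm_velocity_le f j
  calc ‖transport f φ‖ ≤ ∑ _j : Fin 2, S * (‖f‖ * ‖f‖) := norm_sum_le_of_le _ fun j _ => hj j
    _ = 2 * S * ‖f‖ ^ 2 := by
        rw [Fin.sum_univ_two]
        ring

/-- A smooth frequency cutoff `η` for the symbol `m`: its support lies in `{m ≤ l}` and in the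
square `|ξ j| ≤ b`, and its `L²` norm is at most `v`. The condition `high` says that discarding the
low frequencies costs at most the dissipation, `g (‖f‖² - ‖η 𝓕 f‖²) ≤ ∫ m |𝓕 f|²`. -/
structure IsLowPass (m : Plane → ℝ) (g l b v : ℝ) (η : 𝓢(Plane, ℝ)) : Prop where
  nonneg : ∀ ξ, 0 ≤ η ξ
  le_one : ∀ ξ, η ξ ≤ 1
  high : ∀ ξ, g * (1 - η ξ ^ 2) ≤ m ξ
  low : ∀ ξ, η ξ ≠ 0 → m ξ ≤ l
  freq : ∀ ξ j, η ξ ≠ 0 → |ξ j| ≤ b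
  mass : ‖η.toLp 2 (volume : Measure Plane)‖ ≤ v

/-- The low-frequency part of `f`, on the Fourier side. -/
noncomputable def lowPass (η : 𝓢(Plane, ℝ)) (f : L2R) : L2C := cutoff η (𝓕 (toComplex f))

theorem continuous_lowPass (η : 𝓢(Plane, ℝ)) : Continuous (lowPass η) :=
  (cutoff η).continuous.comp
    ((Lp.fourierTransformₗᵢ Plane ℂ).continuous.comp continuous_toComplex)

theorem coeFn_lowPass (η : 𝓢(Plane, ℝ)) (f : L2R) :
    lowPass η f =ᵐ[volume] fun ξ => η ξ • (𝓕 (toComplex f) : L2C) ξ :=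
  coeFn_cutoff η _

theorem pairing_fourierInv_schwartzMul (η : 𝓢(Plane, ℝ)) (f : L2R) (ψ : 𝓢(Plane, ℂ)) :
    pairing f ((𝓕⁻ (schwartzMul η ψ)).toLp 2) = inner ℂ (lowPass η f) (ψ.toLp 2) := by
  rw [pairing_eq_inner, lowPass, inner_cutoff_fourier]

namespace IsLowPass

variable {m : Plane → ℝ} {g l b v : ℝ} {η : 𝓢(Plane, ℝ)}

theorem abs_le_one (h : IsLowPass m g l b v η) (ξ : Plane) : |η ξ| ≤ 1 := by
  rw [abs_of_nonneg (h.nonneg ξ)]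
  exact h.le_one ξ

theorem mass_nonneg (h : IsLowPass m g l b v η) : 0 ≤ v := (norm_nonneg _).trans h.mass

theorem norm_lowPass_le (h : IsLowPass m g l b v η) (f : L2R) : ‖lowPass η f‖ ≤ ‖f‖ := by
  refine (norm_cutoff_le h.abs_le_one _).trans_eq ?_
  rw [Lp.norm_fourier_eq, norm_toComplex]

theorem norm_fderiv_fourierInv_schwartzMul_le (h : IsLowPass m g l b v η) (hb : 0 ≤ b)
    (ψ : 𝓢(Plane, ℂ)) (x : Plane) (j : Fin 2) :
    ‖fderiv ℝ (𝓕⁻ (schwartzMul η ψ) : 𝓢(Plane, ℂ)) x (EuclideanSpace.single j 1)‖ ≤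
      2 * Real.pi * b * (v * ‖ψ.toLp 2‖) := by
  refine (norm_fderiv_fourierInv_le _ x _ (b := b) fun ξ hξ => ?_).trans ?_
  · rw [EuclideanSpace.inner_single_right, one_mul, conj_trivial]
    refine h.freq ξ j fun h₀ => hξ ?_
    rw [schwartzMul_apply, h₀, zero_smul]
  · gcongr
    refine (integral_norm_schwartzMul_le η ψ).trans ?_
    gcongr
    exact h.mass

theorem norm_transport_le (h : IsLowPass m g l b v η) (hb : 0 ≤ b) (f : L2R) (ψ : 𝓢(Plane, ℂ)) :
    ‖transport f (𝓕⁻ (schwartzMul η ψ))‖ ≤ 4 * Real.pi * b * v * ‖f‖ ^ 2 * ‖ψ.toLp 2‖ := by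
  refine (AnisoSQG.norm_transport_le f (h.norm_fderiv_fourierInv_schwartzMul_le hb ψ)).trans_eq ?_
  ring

theorem norm_symbol_mul_schwartzMul_le (h : IsLowPass m g l b v η) (hm₀ : ∀ ξ, 0 ≤ m ξ)
    (ψ : 𝓢(Plane, ℂ)) (ξ : Plane) : ‖(m ξ : ℂ) * schwartzMul η ψ ξ‖ ≤ l * (η ξ * ‖ψ ξ‖) := by
  have hη := h.nonneg ξ
  rw [norm_mul, Complex.norm_real, Real.norm_of_nonneg (hm₀ ξ), schwartzMul_apply, norm_smul,
    Real.norm_of_nonneg hη]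
  by_cases h₀ : η ξ = 0
  · rw [h₀, zero_mul, mul_zero, mul_zero]
  · gcongr
    exact h.low ξ h₀

theorem norm_pairing_multiplier_le (h : IsLowPass m g l b v η) (hm : Measurable m)
    (hm₀ : ∀ ξ, 0 ≤ m ξ) (hl : 0 ≤ l) (f : L2R) (ψ : 𝓢(Plane, ℂ)) :
    ‖pairing f (multiplier (fun ξ => (m ξ : ℂ)) ((𝓕⁻ (schwartzMul η ψ)).toLp 2))‖ ≤
      l * ‖lowPass η f‖ * ‖ψ.toLp 2‖ := by
  have hG : (𝓕 ((𝓕⁻ (schwartzMul η ψ)).toLp 2) : L2C) =ᵐ[volume] schwartzMul η ψ := by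
    rw [SchwartzMap.toLp_fourier_eq, FourierTransform.fourier_fourierInv_eq]
    exact (schwartzMul η ψ).coeFn_toLp 2
  have hmG : (fun ξ => (m ξ : ℂ) * (𝓕 ((𝓕⁻ (schwartzMul η ψ)).toLp 2) : L2C) ξ) =ᵐ[volume]
      fun ξ => (m ξ : ℂ) * schwartzMul η ψ ξ := by
    filter_upwards [hG] with ξ hξ
    rw [hξ]
  have hmem : MemLp (fun ξ => (m ξ : ℂ) * schwartzMul η ψ ξ) 2 := by
    refine (ψ.memLp 2).of_le_mul (c := l) (by fun_prop) (.of_forall fun ξ => ?_)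
    refine (h.norm_symbol_mul_schwartzMul_le hm₀ ψ ξ).trans ?_
    gcongr
    exact mul_le_of_le_one_left (norm_nonneg _) (h.le_one ξ)
  unfold multiplier
  rw [dif_pos ((memLp_congr_ae hmG).2 hmem), pairing_fourierInv, L2.inner_def, mul_assoc]
  refine norm_integral_le_of_norm_le_mul_norm_mul_norm hl _ _ ?_
  filter_upwards [coeFn_lowPass η f, hmG, MemLp.coeFn_toLp ((memLp_congr_ae hmG).2 hmem),
    ψ.coeFn_toLp 2] with ξ hf hξ hξ' hψ
  rw [hf, hψ, hξ', hξ, norm_smul, Real.norm_of_nonneg (h.nonneg ξ)]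
  calc ‖inner ℂ ((𝓕 (toComplex f) : L2C) ξ) ((m ξ : ℂ) * schwartzMul η ψ ξ)‖
      ≤ ‖(𝓕 (toComplex f) : L2C) ξ‖ * ‖(m ξ : ℂ) * schwartzMul η ψ ξ‖ := norm_inner_le_norm _ _
    _ ≤ ‖(𝓕 (toComplex f) : L2C) ξ‖ * (l * (η ξ * ‖ψ ξ‖)) := by
        gcongr
        exact h.norm_symbol_mul_schwartzMul_le hm₀ ψ ξ
    _ = l * (η ξ * ‖(𝓕 (toComplex f) : L2C) ξ‖ * ‖ψ ξ‖) := by ring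

theorem norm_lowPass_le_of_memLp (h : IsLowPass m g l b v η) {p : ℝ} (hp : 1 ≤ p) (hp₂ : p ≤ 2)
    {f : L2R} (hf : MemLp f (.ofReal p)) :
    ‖lowPass η f‖ ≤ v ^ (2 / p - 1) * (eLpNorm f (.ofReal p)).toReal := by
  have hf' : MemLp (toComplex f) (.ofReal p) :=
    ⟨Lp.aestronglyMeasurable _, (eLpNorm_toComplex f _).trans_lt hf.2⟩
  rw [← eLpNorm_toComplex]
  refine (norm_cutoff_fourier_le_of_memLp h.abs_le_one hp hp₂ hf').trans ?_
  have : 0 ≤ 2 / p - 1 := by rw [sub_nonneg, one_le_div (by linarith)]; exact hp₂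
  gcongr
  exact h.mass

theorem ofReal_mul_enorm_sq_le (h : IsLowPass m g l b v η) (hg : 0 ≤ g) (hm₀ : ∀ ξ, 0 ≤ m ξ)
    (hm : Measurable m) (f : L2R) :
    .ofReal g * ‖f‖ₑ ^ 2 ≤ dissipation m f + .ofReal g * ‖lowPass η f‖ₑ ^ 2 := by
  have hf : ‖f‖ₑ = ‖(𝓕 (toComplex f) : L2C)‖ₑ := by
    rw [← ofReal_norm, ← ofReal_norm, Lp.norm_fourier_eq, norm_toComplex]
  rw [hf, enorm_sq_eq_lintegral, enorm_sq_eq_lintegral, dissipation,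
    ← lintegral_const_mul' _ _ ENNReal.ofReal_ne_top, ← lintegral_const_mul' _ _
    ENNReal.ofReal_ne_top, ← lintegral_add_left' (by fun_prop)]
  refine lintegral_mono_ae ?_
  filter_upwards [coeFn_lowPass η f] with ξ hξ
  have hη : g ≤ m ξ + g * ‖η ξ‖ ^ 2 := by
    rw [Real.norm_eq_abs, sq_abs]
    linarith [h.high ξ]
  rw [hξ, enorm_smul, mul_pow, ← mul_assoc, ← add_mul]
  gcongr
  rw [← ofReal_norm (η ξ), ← ENNReal.ofReal_pow (norm_nonneg _), ← ENNReal.ofReal_mul hg,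
    ← ENNReal.ofReal_add (hm₀ ξ) (by positivity)]
  exact ENNReal.ofReal_le_ofReal hη

theorem le_dissipation (h : IsLowPass m g l b v η) (hg : 0 ≤ g) (hm₀ : ∀ ξ, 0 ≤ m ξ)
    (hm : Measurable m) (f : L2R) :
    .ofReal (g * (‖f‖ ^ 2 - ‖lowPass η f‖ ^ 2)) ≤ dissipation m f := by
  rw [mul_sub, ENNReal.ofReal_sub _ (by positivity), tsub_le_iff_right, ENNReal.ofReal_mul hg,
    ENNReal.ofReal_mul hg, ENNReal.ofReal_pow (norm_nonneg _), ENNReal.ofReal_pow (norm_nonneg _),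
    ofReal_norm, ofReal_norm]
  exact h.ofReal_mul_enorm_sq_le hg hm₀ hm f

end IsLowPass

theorem norm_integral_le_mul_integral_mul {f : ℝ → ℂ} {y : ℝ → ℝ} {c N t : ℝ}
    (hy : IntervalIntegrable y volume 0 t) (ht : 0 ≤ t) (h : ∀ s, ‖f s‖ ≤ c * y s * N) :
    ‖∫ s in (0 : ℝ)..t, f s‖ ≤ c * (∫ s in (0 : ℝ)..t, y s) * N := by
  have := intervalIntegral.norm_integral_le_of_norm_le ht (g := fun s => c * y s * N)
    (.of_forall fun s _ => h s) ((hy.const_mul _).mul_const _)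
  rwa [intervalIntegral.integral_mul_const, intervalIntegral.integral_const_mul] at this

theorem ofReal_integral_le_lintegral {X : Type*} [MeasurableSpace X] {μ : Measure X} {f : X → ℝ}
    (hf : Integrable f μ) : ENNReal.ofReal (∫ x, f x ∂μ) ≤ ∫⁻ x, ENNReal.ofReal (f x) ∂μ := by
  rw [integral_eq_lintegral_pos_part_sub_lintegral_neg_part hf]
  exact (ENNReal.ofReal_le_ofReal (sub_le_self _ ENNReal.toReal_nonneg)).trans
    ENNReal.ofReal_toReal_le

theorem norm_sq_add_integral_le {V : Type*} [NormedAddCommGroup V] {f : ℝ → ℝ} {D : ℝ → ℝ≥0∞}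
    {s t : ℝ} {u w : V} (hst : s ≤ t) (hf : IntervalIntegrable f volume s t)
    (hD : ∀ τ ∈ Icc s t, ENNReal.ofReal (f τ) ≤ D τ)
    (h : ‖u‖ₑ ^ 2 + 2 * ∫⁻ τ in Icc s t, D τ ≤ ‖w‖ₑ ^ 2) :
    ‖u‖ ^ 2 + ∫ τ in s..t, 2 * f τ ≤ ‖w‖ ^ 2 := by
  rw [intervalIntegrable_iff_integrableOn_Icc_of_le hst] at hf
  have hle : ENNReal.ofReal (∫ τ in s..t, 2 * f τ) ≤ 2 * ∫⁻ τ in Icc s t, D τ := by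
    rw [intervalIntegral.integral_const_mul, ENNReal.ofReal_mul zero_le_two,
      intervalIntegral.integral_of_le hst, ← integral_Icc_eq_integral_Ioc, ENNReal.ofReal_ofNat]
    gcongr
    exact (ofReal_integral_le_lintegral hf).trans (setLIntegral_mono' measurableSet_Icc hD)
  rw [← ENNReal.ofReal_le_ofReal_iff (by positivity)]
  refine ENNReal.ofReal_add_le.trans ?_
  rw [ENNReal.ofReal_pow (norm_nonneg _), ENNReal.ofReal_pow (norm_nonneg _), ofReal_norm,
    ofReal_norm]
  exact (add_le_add_right hle _).trans h

namespace IsWeakSolution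

variable {m : Plane → ℝ} {g l b v : ℝ} {η : 𝓢(Plane, ℝ)} {θ₀ : L2R} {θ : ℝ → L2R}

theorem norm_le (h : IsWeakSolution m θ₀ θ) {t : ℝ} (ht : 0 ≤ t) : ‖θ t‖ ≤ ‖θ₀‖ :=
  enorm_le_iff_norm_le.1 <| (ENNReal.pow_le_pow_left_iff two_ne_zero).1 <|
    le_self_add.trans (h.energy_zero t ht)

theorem aestronglyMeasurable_norm_sq (h : IsWeakSolution m θ₀ θ) :
    AEStronglyMeasurable (fun s => ‖θ s‖ ^ 2) (volume.restrict (Ici (0 : ℝ))) :=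
  h.measurable.norm.pow 2

theorem intervalIntegrable_norm_sq (h : IsWeakSolution m θ₀ θ) {s t : ℝ} (hs : 0 ≤ s)
    (hst : s ≤ t) : IntervalIntegrable (fun τ => ‖θ τ‖ ^ 2) volume s t := by
  refine intervalIntegrable_of_norm_le (E := ‖θ₀‖ ^ 2) h.aestronglyMeasurable_norm_sq
    (fun τ hτ => ?_) hs hst
  rw [norm_pow, norm_norm]
  gcongr
  exact h.norm_le hτ

theorem intervalIntegrable_norm_lowPass (h : IsWeakSolution m θ₀ θ) (hη : IsLowPass m g l b v η)
    {t : ℝ} (ht : 0 ≤ t) : IntervalIntegrable (fun s => ‖lowPass η (θ s)‖) volume 0 t :=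
  intervalIntegrable_of_norm_le (E := ‖θ₀‖)
    ((continuous_lowPass η).norm.comp_aestronglyMeasurable h.measurable)
    (fun s hs => by
      rw [norm_norm]
      exact (hη.norm_lowPass_le _).trans (h.norm_le hs)) le_rfl ht

theorem norm_lowPass_le_add_integral (h : IsWeakSolution m θ₀ θ) (hη : IsLowPass m g l b v η)
    (hm : Measurable m) (hm₀ : ∀ ξ, 0 ≤ m ξ) (hl : 0 ≤ l) (hb : 0 ≤ b) {t : ℝ} (ht : 0 ≤ t) :
    ‖lowPass η (θ t)‖ ≤ ‖lowPass η θ₀‖ + 4 * Real.pi * b * v * (∫ s in (0 : ℝ)..t, ‖θ s‖ ^ 2)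
      + l * ∫ s in (0 : ℝ)..t, ‖lowPass η (θ s)‖ := by
  have hv := hη.mass_nonneg
  have hint : 0 ≤ ∫ s in (0 : ℝ)..t, ‖θ s‖ ^ 2 :=
    intervalIntegral.integral_nonneg ht fun _ _ => by positivity
  have hint' : 0 ≤ ∫ s in (0 : ℝ)..t, ‖lowPass η (θ s)‖ :=
    intervalIntegral.integral_nonneg ht fun _ _ => norm_nonneg _
  refine norm_cutoff_fourier_le_of_forall (by positivity) fun ψ => ?_
  rw [← pairing_eq_inner, h.weak_form _ t ht]
  have hinit := norm_inner_le_norm (𝕜 := ℂ) (lowPass η θ₀) (ψ.toLp 2)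
  rw [← pairing_fourierInv_schwartzMul] at hinit
  have htransport := norm_integral_le_mul_integral_mul (h.intervalIntegrable_norm_sq le_rfl ht) ht
    fun s => hη.norm_transport_le hb (θ s) ψ
  have hdiffusion := norm_integral_le_mul_integral_mul (h.intervalIntegrable_norm_lowPass hη ht) ht
    fun s => hη.norm_pairing_multiplier_le hm hm₀ hl (θ s) ψ
  rw [add_mul, add_mul]
  exact (norm_sub_le _ _).trans
    (add_le_add ((norm_add_le _ _).trans (add_le_add hinit htransport)) hdiffusion)

theorem norm_lowPass_le (h : IsWeakSolution m θ₀ θ) (hη : IsLowPass m g l b v η)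
    (hm : Measurable m) (hm₀ : ∀ ξ, 0 ≤ m ξ) (hl : 0 < l) (hb : 0 ≤ b) {T : ℝ} (hT : 0 ≤ T) :
    ‖lowPass η (θ T)‖ ≤
      2 * (‖lowPass η θ₀‖ + 4 * Real.pi * b * v * ∫ s in (0 : ℝ)..T, ‖θ s‖ ^ 2) *
        Real.exp (2 * l * T) := by
  have hv := hη.mass_nonneg
  have hint : 0 ≤ ∫ s in (0 : ℝ)..T, ‖θ s‖ ^ 2 :=
    intervalIntegral.integral_nonneg hT fun _ _ => by positivity
  refine le_mul_exp_of_le_add_integral (f := fun t => ‖lowPass η (θ t)‖) (E := ‖θ₀‖) hT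
    (by positivity) hl (h.intervalIntegrable_norm_lowPass hη hT) (fun _ _ => norm_nonneg _)
    (fun t ht => (hη.norm_lowPass_le _).trans (h.norm_le ht.1)) fun t ht => ?_
  refine (h.norm_lowPass_le_add_integral hη hm hm₀ hl.le hb ht.1).trans ?_
  gcongr
  exact intervalIntegral.integral_mono_interval le_rfl ht.1 ht.2
    (.of_forall fun s => by positivity) (h.intervalIntegrable_norm_sq le_rfl hT)

end IsWeakSolution

/-! ### Anisotropic symbols -/

section SmoothCutoff

variable {V : Type*} [NormedAddCommGroup V] [InnerProductSpace ℝ V] [FiniteDimensional ℝ V]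

theorem exists_schwartzMap_eq_one_of_subset_interior {s t : Set V} (hs : IsClosed s)
    (ht : IsCompact t) (hst : s ⊆ interior t) :
    ∃ η : 𝓢(V, ℝ), (∀ ξ, η ξ ∈ Icc 0 1) ∧ (∀ ξ ∈ s, η ξ = 1) ∧ ∀ ξ, η ξ ≠ 0 → ξ ∈ t := by
  obtain ⟨f, hf₀, hf₁, hf⟩ := exists_contMDiffMap_zero_one_of_isClosed (n := ⊤)
    (modelWithCornersSelf ℝ V) (isOpen_interior (s := t)).isClosed_compl hs
    (disjoint_compl_left_iff_subset.2 hst)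
  have hsupp : ∀ ξ ∉ t, f ξ = 0 := fun ξ hξ => hf₀ fun h => hξ (interior_subset h)
  exact ⟨(HasCompactSupport.intro ht hsupp).toSchwartzMap f.contMDiff.contDiff, hf, hf₁,
    fun ξ hξ => by_contra fun h => hξ (hsupp ξ h)⟩

theorem norm_toLp_le_sqrt_measureReal [MeasurableSpace V] [BorelSpace V] {η : 𝓢(V, ℝ)} {s : Set V}
    (hs : volume s ≠ ⊤) (hη : ∀ ξ, |η ξ| ≤ 1) (hsupp : ∀ ξ, η ξ ≠ 0 → ξ ∈ s) :
    ‖η.toLp 2 (volume : Measure V)‖ ≤ √(volume.real s) := by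
  have hle : eLpNorm η 2 volume ≤ volume s ^ (1 / 2 : ℝ) := by
    rw [← eLpNorm_restrict_eq_of_support_subset (s := s) fun ξ hξ => hsupp ξ hξ]
    simpa using eLpNorm_le_of_ae_bound (f := η) (μ := volume.restrict s) (p := 2) (.of_forall hη)
  rw [SchwartzMap.norm_toLp, Real.sqrt_eq_rpow, Measure.real, ENNReal.toReal_rpow]
  exact ENNReal.toReal_mono (ENNReal.rpow_ne_top_of_nonneg (by norm_num) hs) hle

end SmoothCutoff

section CoordBox

variable {ι : Type*}

/-- The box `|ξ j| ≤ a j` in Euclidean space. -/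
def coordBox (a : ι → ℝ) : Set (EuclideanSpace ℝ ι) := {ξ | ∀ j, |ξ j| ≤ a j}

theorem coordBox_eq_preimage (a : ι → ℝ) : coordBox a = WithLp.ofLp ⁻¹' Icc (-a) a := by
  ext ξ
  simp only [coordBox, abs_le, forall_and, mem_ofPred_eq, mem_preimage, mem_Icc, Pi.le_def,
    Pi.neg_apply]

theorem isCompact_coordBox (a : ι → ℝ) : IsCompact (coordBox a) := by
  rw [coordBox_eq_preimage]
  exact (PiLp.homeomorph 2 fun _ : ι => ℝ).isCompact_preimage.2 isCompact_Icc

theorem coordBox_subset_interior [Finite ι] {a b : ι → ℝ} (h : ∀ j, a j < b j) :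
    coordBox a ⊆ interior (coordBox b) := by
  have hopen : IsOpen {ξ : EuclideanSpace ℝ ι | ∀ j, |ξ j| < b j} := by
    rw [ofPred_forall]
    exact isOpen_iInter_of_finite fun j => isOpen_lt (by fun_prop) continuous_const
  exact fun ξ hξ => interior_maximal (fun ζ hζ j => (hζ j).le) hopen fun j => (hξ j).trans_lt (h j)

theorem volume_coordBox [Fintype ι] (a : ι → ℝ) :
    volume (coordBox a) = ∏ j, ENNReal.ofReal (2 * a j) := by
  rw [coordBox_eq_preimage, (PiLp.volume_preserving_ofLp ι).measure_preimage
    measurableSet_Icc.nullMeasurableSet, Real.volume_Icc_pi]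
  simp only [Pi.neg_apply, sub_neg_eq_add, two_mul]

end CoordBox

section Symbol

variable {α β c h s : ℝ} {m : Plane → ℝ}

/-- The half-width of the slab `|2 π x| ^ (2 s) ≤ h`. -/
noncomputable def freqRadius (s h : ℝ) : ℝ := h ^ (1 / (2 * s)) / (2 * Real.pi)

theorem freqRadius_pos (s : ℝ) (hh : 0 < h) : 0 < freqRadius s h := by
  unfold freqRadius
  positivity

theorem le_rpow_of_freqRadius_lt {x : ℝ} (hs : 0 < s) (hh : 0 < h) (hx : freqRadius s h < |x|) :
    h ≤ |2 * Real.pi * x| ^ (2 * s) := by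
  rw [freqRadius, div_lt_iff₀ Real.two_pi_pos] at hx
  calc h = (h ^ (1 / (2 * s))) ^ (2 * s) := by
        rw [← Real.rpow_mul hh.le, one_div_mul_cancel (by positivity), Real.rpow_one]
    _ ≤ |2 * Real.pi * x| ^ (2 * s) := by
        rw [abs_mul, abs_of_pos Real.two_pi_pos, mul_comm (2 * Real.pi)]
        gcongr

theorem rpow_le_of_le_two_mul_freqRadius {x : ℝ} (hs : 0 < s) (hs₁ : s ≤ 1) (hh : 0 < h)
    (hx : |x| ≤ 2 * freqRadius s h) : |2 * Real.pi * x| ^ (2 * s) ≤ 4 * h := by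
  have : 2 * Real.pi * |x| ≤ 2 * h ^ (1 / (2 * s)) := by
    refine (mul_le_mul_of_nonneg_left hx Real.two_pi_pos.le).trans_eq ?_
    rw [freqRadius]
    field_simp
  calc |2 * Real.pi * x| ^ (2 * s) = (2 * Real.pi * |x|) ^ (2 * s) := by
        rw [abs_mul, abs_of_pos Real.two_pi_pos]
    _ ≤ (2 * h ^ (1 / (2 * s))) ^ (2 * s) := by gcongr
    _ = 2 ^ (2 * s) * h := by
        rw [Real.mul_rpow zero_le_two (by positivity), ← Real.rpow_mul hh.le,
          one_div_mul_cancel (by positivity), Real.rpow_one]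
    _ ≤ 2 ^ (2 : ℝ) * h := by
        gcongr
        exacts [one_le_two, by linarith]
    _ = 4 * h := by norm_num

/-- `m` is comparable, with constant `c`, to the symbol of `Λ_{x₁}^{2α} + Λ_{x₂}^{2β}`. -/
structure IsComparableSymbol (α β c : ℝ) (m : Plane → ℝ) : Prop where
  pos : 0 < c
  measurable : Measurable m
  anisotropicSymbol_le : ∀ ξ, anisotropicSymbol α β ξ ≤ c * m ξ
  le_anisotropicSymbol : ∀ ξ, m ξ ≤ c * anisotropicSymbol α β ξ

theorem anisotropicSymbol_nonneg (α β : ℝ) (ξ : Plane) : 0 ≤ anisotropicSymbol α β ξ := by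
  unfold anisotropicSymbol
  positivity

theorem IsComparableSymbol.nonneg (hm : IsComparableSymbol α β c m) (ξ : Plane) : 0 ≤ m ξ :=
  nonneg_of_mul_nonneg_right
    ((anisotropicSymbol_nonneg α β ξ).trans (hm.anisotropicSymbol_le ξ)) hm.pos

theorem isComparableSymbol_anisotropicSymbol (α β : ℝ) :
    IsComparableSymbol α β 1 (anisotropicSymbol α β) where
  pos := one_pos
  measurable := by
    unfold anisotropicSymbol
    fun_prop
  anisotropicSymbol_le ξ := (one_mul _).ge
  le_anisotropicSymbol ξ := (one_mul _).ge

theorem abs_two_pi_mul_apply_le (ξ : Plane) (j : Fin 2) :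
    |2 * Real.pi * ξ j| ≤ 2 * Real.pi * ‖ξ‖ := by
  rw [abs_mul, abs_of_pos Real.two_pi_pos]
  gcongr
  exact PiLp.norm_apply_le ξ j

theorem sq_two_pi_mul_norm (ξ : Plane) :
    (2 * Real.pi * ‖ξ‖) ^ 2 = |2 * Real.pi * ξ 0| ^ 2 + |2 * Real.pi * ξ 1| ^ 2 := by
  rw [mul_pow, EuclideanSpace.norm_sq_eq, Fin.sum_univ_two, Real.norm_eq_abs, Real.norm_eq_abs]
  simp only [sq_abs]
  ring

theorem isotropicSymbol_le_anisotropicSymbol (hα : 0 < α) (hα₁ : α ≤ 1) (ξ : Plane) :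
    isotropicSymbol α ξ ≤ anisotropicSymbol α α ξ := by
  have hpow (x : ℝ) (hx : 0 ≤ x) : x ^ (2 * α) = (x ^ 2) ^ α := by
    rw [← Real.rpow_natCast_mul hx, Nat.cast_ofNat]
  unfold isotropicSymbol anisotropicSymbol
  rw [hpow _ (by positivity), hpow _ (abs_nonneg _), hpow _ (abs_nonneg _), sq_two_pi_mul_norm]
  exact Real.rpow_add_le_add_rpow (by positivity) (by positivity) hα.le hα₁

theorem isComparableSymbol_isotropicSymbol (hα : 0 < α) (hα₁ : α ≤ 1) :
    IsComparableSymbol α α 2 (isotropicSymbol α) where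
  pos := two_pos
  measurable := by
    unfold isotropicSymbol
    fun_prop
  anisotropicSymbol_le ξ := by
    unfold anisotropicSymbol isotropicSymbol
    rw [two_mul ((2 * Real.pi * ‖ξ‖) ^ (2 * α))]
    gcongr <;> exact abs_two_pi_mul_apply_le ξ _
  le_anisotropicSymbol ξ := by
    linarith [isotropicSymbol_le_anisotropicSymbol hα hα₁ ξ, anisotropicSymbol_nonneg α α ξ]

/-- The homogeneous dimension of the scaling `(ξ₁, ξ₂) ↦ (λ ^ (1 / (2α)) ξ₁, λ ^ (1 / (2β)) ξ₂)`,
under which the symbol of `Λ_{x₁}^{2α} + Λ_{x₂}^{2β}` is homogeneous of degree `1`. -/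
noncomputable def anisotropicDim (α β : ℝ) : ℝ := 1 / (2 * α) + 1 / (2 * β)

/-- The half-widths of a box outside of which the symbol of `Λ_{x₁}^{2α} + Λ_{x₂}^{2β}` is at
least `h`. -/
noncomputable def freqBox (α β h : ℝ) : Fin 2 → ℝ := ![freqRadius α h, freqRadius β h]

theorem freqBox_pos (α β : ℝ) (hh : 0 < h) (j : Fin 2) : 0 < freqBox α β h j := by
  fin_cases j
  exacts [freqRadius_pos α hh, freqRadius_pos β hh]

theorem le_anisotropicSymbol_of_notMem (hα : 0 < α) (hβ : 0 < β) (hh : 0 < h) {ξ : Plane}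
    (hξ : ξ ∉ coordBox (freqBox α β h)) : h ≤ anisotropicSymbol α β ξ := by
  simp only [coordBox, mem_ofPred_eq, Fin.forall_fin_two, not_and_or, not_le] at hξ
  rcases hξ with hξ | hξ
  · exact (le_rpow_of_freqRadius_lt hα hh hξ).trans (le_add_of_nonneg_right (by positivity))
  · exact (le_rpow_of_freqRadius_lt hβ hh hξ).trans (le_add_of_nonneg_left (by positivity))

theorem anisotropicSymbol_le_of_mem (hα : 0 < α) (hα₁ : α ≤ 1) (hβ : 0 < β) (hβ₁ : β ≤ 1)
    (hh : 0 < h) {ξ : Plane} (hξ : ξ ∈ coordBox fun j => 2 * freqBox α β h j) :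
    anisotropicSymbol α β ξ ≤ 8 * h := by
  have h₀ := rpow_le_of_le_two_mul_freqRadius hα hα₁ hh (hξ 0)
  have h₁ := rpow_le_of_le_two_mul_freqRadius hβ hβ₁ hh (hξ 1)
  unfold anisotropicSymbol
  linarith

theorem two_mul_freqRadius_le (s : ℝ) (hh : 0 < h) :
    2 * freqRadius s h ≤ h ^ (1 / (2 * s)) / 2 := by
  have : (h ^ (1 / (2 * s))) / Real.pi ≤ h ^ (1 / (2 * s)) / 2 := by
    gcongr
    exact Real.two_le_pi
  refine Eq.trans_le ?_ this
  rw [freqRadius]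
  field_simp

theorem measureReal_coordBox_le (α β : ℝ) (hh : 0 < h) :
    volume.real (coordBox fun j => 2 * freqBox α β h j) ≤ h ^ anisotropicDim α β := by
  have hpos (j : Fin 2) : 0 ≤ 2 * (2 * freqBox α β h j) :=
    mul_nonneg zero_le_two (mul_pos two_pos (freqBox_pos α β hh j)).le
  rw [Measure.real, volume_coordBox, Fin.prod_univ_two, ENNReal.toReal_mul, anisotropicDim,
    Real.rpow_add hh, ENNReal.toReal_ofReal (hpos 0), ENNReal.toReal_ofReal (hpos 1)]
  have h₀ := two_mul_freqRadius_le α hh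
  have h₁ := two_mul_freqRadius_le β hh
  simp only [freqBox, Matrix.cons_val_zero, Matrix.cons_val_one, Matrix.cons_val_fin_one]
  exact mul_le_mul (by linarith) (by linarith) (hpos 1) (by positivity)

theorem abs_apply_le_of_mem (hh : 0 < h) {ξ : Plane}
    (hξ : ξ ∈ coordBox fun j => 2 * freqBox α β h j) (j : Fin 2) :
    |ξ j| ≤ h ^ (1 / (2 * α)) + h ^ (1 / (2 * β)) := by
  have hα : 0 < h ^ (1 / (2 * α)) := by positivity
  have hβ : 0 < h ^ (1 / (2 * β)) := by positivity
  have h₀ := (hξ 0).trans (two_mul_freqRadius_le α hh)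
  have h₁ := (hξ 1).trans (two_mul_freqRadius_le β hh)
  fin_cases j
  · exact h₀.trans (by linarith)
  · exact h₁.trans (by linarith)

theorem IsComparableSymbol.exists_isLowPass (hm : IsComparableSymbol α β c m) (hα : 0 < α)
    (hα₁ : α ≤ 1) (hβ : 0 < β) (hβ₁ : β ≤ 1) (hh : 0 < h) :
    ∃ η, IsLowPass m (h / c) (8 * c * h) (h ^ (1 / (2 * α)) + h ^ (1 / (2 * β)))
      √(h ^ anisotropicDim α β) η := by
  obtain ⟨η, hη, hη_one, hη_supp⟩ := exists_schwartzMap_eq_one_of_subset_interior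
    (isCompact_coordBox (freqBox α β h)).isClosed (isCompact_coordBox fun j => 2 * freqBox α β h j)
    (coordBox_subset_interior fun j => lt_two_mul_self (freqBox_pos α β hh j))
  refine ⟨η, fun ξ => (hη ξ).1, fun ξ => (hη ξ).2, fun ξ => ?_, fun ξ hξ => ?_,
    fun ξ j hξ => abs_apply_le_of_mem hh (hη_supp ξ hξ) j, ?_⟩
  · by_cases hξ : ξ ∈ coordBox (freqBox α β h)
    · rw [hη_one ξ hξ, one_pow, sub_self, mul_zero]
      exact hm.nonneg ξ
    · calc h / c * (1 - η ξ ^ 2) ≤ h / c :=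
            mul_le_of_le_one_right (div_pos hh hm.pos).le (sub_le_self _ (sq_nonneg _))
        _ ≤ m ξ := (div_le_iff₀' hm.pos).2 <|
            (le_anisotropicSymbol_of_notMem hα hβ hh hξ).trans (hm.anisotropicSymbol_le ξ)
  · have := mul_le_mul_of_nonneg_left
      (anisotropicSymbol_le_of_mem hα hα₁ hβ hβ₁ hh (hη_supp ξ hξ)) hm.pos.le
    linarith [hm.le_anisotropicSymbol ξ]
  · refine (norm_toLp_le_sqrt_measureReal (isCompact_coordBox _).measure_ne_top
      (fun ξ => abs_le.2 ⟨by linarith [(hη ξ).1], (hη ξ).2⟩) hη_supp).trans ?_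
    exact Real.sqrt_le_sqrt (measureReal_coordBox_le α β hh)

end Symbol

/-! ### Decay of weak solutions -/

section Decay

variable {α β c p N κ : ℝ} {m : Plane → ℝ} {θ₀ : L2R} {θ : ℝ → L2R}

/-- The decay rate of `‖θ‖²` for initial values in `Lᵖ`. -/
noncomputable def decayRate (α β p : ℝ) : ℝ := anisotropicDim α β * (2 / p - 1)

/-- The coefficient with which initial values of `Lᵖ` norm `N` contribute to the low-frequency
bound for a symbol of comparability constant `c`. -/
noncomputable def dataCoeff (α β c p N κ : ℝ) : ℝ :=
  8 * Real.exp (32 * c ^ 2 * κ) * N ^ 2 * (c * κ) ^ decayRate α β p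

/-- The coefficient of the contribution of the nonlinearity to the low-frequency bound. -/
noncomputable def transportCoeff (α β c κ : ℝ) : ℝ :=
  256 * Real.pi ^ 2 * Real.exp (32 * c ^ 2 * κ) *
    ((c * κ) ^ (1 / α + anisotropicDim α β) + (c * κ) ^ (1 / β + anisotropicDim α β))

theorem one_le_anisotropicDim (hα : 0 < α) (hα₁ : α ≤ 1) (hβ : 0 < β) (hβ₁ : β ≤ 1) :
    1 ≤ anisotropicDim α β := by
  have h {s : ℝ} (hs : 0 < s) (hs₁ : s ≤ 1) : 1 / 2 ≤ 1 / (2 * s) := by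
    gcongr
    linarith
  unfold anisotropicDim
  linarith [h hα hα₁, h hβ hβ₁]

theorem decayRate_pos (hα : 0 < α) (hβ : 0 < β) (hp : 0 < p) (hp₂ : p < 2) :
    0 < decayRate α β p := by
  have : 0 < 2 / p - 1 := sub_pos.2 ((one_lt_div hp).2 hp₂)
  unfold decayRate anisotropicDim
  positivity

theorem decayRate_le_anisotropicDim (hα : 0 < α) (hβ : 0 < β) (hp : 1 ≤ p) :
    decayRate α β p ≤ anisotropicDim α β := by
  have hp' : 2 / p - 1 ≤ 1 := by
    rw [tsub_le_iff_right, div_le_iff₀ (by linarith)]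
    linarith
  refine mul_le_of_le_one_right ?_ hp'
  unfold anisotropicDim
  positivity

theorem decayRate_eq (hα : α ≠ 0) (hβ : β ≠ 0) (hp : p ≠ 0) :
    decayRate α β p = (α + β) * (2 - p) / (4 * α * β * p) * 2 := by
  unfold decayRate anisotropicDim
  field_simp
  ring

theorem dataCoeff_nonneg (α β p N : ℝ) (hc : 0 < c) (hκ : 0 < κ) :
    0 ≤ dataCoeff α β c p N κ := by
  unfold dataCoeff
  positivity

theorem transportCoeff_nonneg (α β : ℝ) (hc : 0 < c) (hκ : 0 < κ) :
    0 ≤ transportCoeff α β c κ := by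
  unfold transportCoeff
  positivity

theorem tendsto_transportCoeff (hα : 0 < α) (hβ : 0 < β) (c : ℝ) :
    Filter.Tendsto (transportCoeff α β c) (nhdsWithin 0 (Ioi 0)) (nhds 0) := by
  have hdim : 0 < anisotropicDim α β := by
    unfold anisotropicDim
    positivity
  have h₀ : transportCoeff α β c 0 = 0 := by
    unfold transportCoeff
    rw [mul_zero, mul_zero, Real.zero_rpow (by positivity), Real.zero_rpow (by positivity),
      add_zero, mul_zero]
  have hcont : ContinuousAt (transportCoeff α β c) 0 := by
    unfold transportCoeff
    have (e : ℝ) (he : 0 < e) : ContinuousAt (fun κ => (c * κ) ^ e) 0 :=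
      (continuousAt_const.mul continuousAt_id).rpow_const (Or.inr he.le)
    have hcoeff : ContinuousAt (fun κ => 256 * Real.pi ^ 2 * Real.exp (32 * c ^ 2 * κ)) 0 := by
      fun_prop
    exact hcoeff.mul
      ((this _ (by positivity)).add (this _ (by positivity)))
  have hlim := hcont.tendsto
  rw [h₀] at hlim
  exact hlim.mono_left nhdsWithin_le_nhds

theorem div_rpow_le {x u e f : ℝ} (hx : 0 ≤ x) (hu : 1 ≤ u) (hef : e ≤ f) :
    (x / u) ^ f ≤ x ^ f * u ^ (-e) := by
  have : 0 ≤ u := zero_le_one.trans hu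
  rw [Real.div_rpow hx this, div_eq_mul_inv, ← Real.rpow_neg this]
  gcongr

theorem transport_level_le {u : ℝ} (hα : 0 < α) (hα₁ : α ≤ 1) (hβ : 0 < β) (hβ₁ : β ≤ 1)
    (hκ : 0 < κ) (hu : 1 ≤ u) :
    ((κ / u) ^ (1 / (2 * α)) + (κ / u) ^ (1 / (2 * β))) ^ 2 * (κ / u) ^ anisotropicDim α β ≤
      2 * (κ ^ (1 / α + anisotropicDim α β) + κ ^ (1 / β + anisotropicDim α β)) *
        u ^ (-(1 + anisotropicDim α β)) := by
  have hpos : 0 < κ / u := by positivity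
  have hsq {s : ℝ} : ((κ / u) ^ (1 / (2 * s))) ^ 2 = (κ / u) ^ (1 / s) := by
    rw [← Real.rpow_mul_natCast hpos.le]
    congr 1
    push_cast
    ring
  have hterm {s : ℝ} (hs : 0 < s) (hs₁ : s ≤ 1) :
      (κ / u) ^ (1 / s) * (κ / u) ^ anisotropicDim α β ≤
        κ ^ (1 / s + anisotropicDim α β) * u ^ (-(1 + anisotropicDim α β)) := by
    rw [← Real.rpow_add hpos]
    refine div_rpow_le hκ.le hu ?_
    gcongr
    exact (one_le_div hs).2 hs₁
  calc ((κ / u) ^ (1 / (2 * α)) + (κ / u) ^ (1 / (2 * β))) ^ 2 * (κ / u) ^ anisotropicDim α β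
      ≤ 2 * ((κ / u) ^ (1 / α) + (κ / u) ^ (1 / β)) * (κ / u) ^ anisotropicDim α β := by
        rw [← hsq (s := α), ← hsq (s := β)]
        exact mul_le_mul_of_nonneg_right add_sq_le (by positivity)
    _ = 2 * ((κ / u) ^ (1 / α) * (κ / u) ^ anisotropicDim α β +
          (κ / u) ^ (1 / β) * (κ / u) ^ anisotropicDim α β) := by ring
    _ ≤ 2 * (κ ^ (1 / α + anisotropicDim α β) * u ^ (-(1 + anisotropicDim α β)) +
          κ ^ (1 / β + anisotropicDim α β) * u ^ (-(1 + anisotropicDim α β))) :=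
        mul_le_mul_of_nonneg_left (add_le_add (hterm hα hα₁) (hterm hβ hβ₁)) zero_le_two
    _ = _ := by ring

theorem exp_level_le {t : ℝ} (hκ : 0 < κ) (ht : 0 ≤ t) (c : ℝ) :
    Real.exp (2 * (8 * c * (c * κ / (1 + t))) * t) ≤ Real.exp (16 * c ^ 2 * κ) := by
  have : t / (1 + t) ≤ 1 := div_le_one_of_le₀ (by linarith) (by linarith)
  refine Real.exp_le_exp.2 ?_
  calc 2 * (8 * c * (c * κ / (1 + t))) * t = 16 * c ^ 2 * κ * (t / (1 + t)) := by ring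
    _ ≤ 16 * c ^ 2 * κ := mul_le_of_le_one_right (by positivity) this

theorem IsWeakSolution.sq_norm_lowPass_le {g b q : ℝ} {η : 𝓢(Plane, ℝ)}
    (hθ : IsWeakSolution m θ₀ θ) (hm : IsComparableSymbol α β c m) (hp : 1 ≤ p) (hp₂ : p < 2)
    (hθ₀ : MemLp θ₀ (.ofReal p)) {t : ℝ} (hκ : 0 < κ) (ht : 0 ≤ t) (hb : 0 ≤ b) (hq : 0 ≤ q)
    (hη : IsLowPass m g (8 * c * (c * κ / (1 + t))) b √q η) :
    ‖lowPass η (θ t)‖ ^ 2 ≤ 8 * Real.exp (32 * c ^ 2 * κ) *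
      (q ^ (2 / p - 1) * (eLpNorm θ₀ (.ofReal p)).toReal ^ 2 +
        16 * Real.pi ^ 2 * (b ^ 2 * q) * (∫ τ in (0 : ℝ)..t, ‖θ τ‖ ^ 2) ^ 2) := by
  have hc := hm.pos
  set N := (eLpNorm θ₀ (.ofReal p)).toReal
  set Y := ∫ τ in (0 : ℝ)..t, ‖θ τ‖ ^ 2
  have hY : 0 ≤ Y := intervalIntegral.integral_nonneg ht fun _ _ => by positivity
  have hle : ‖lowPass η (θ t)‖ ≤ 2 * (√q ^ (2 / p - 1) * N + 4 * Real.pi * b * √q * Y) *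
      Real.exp (16 * c ^ 2 * κ) := by
    refine (hθ.norm_lowPass_le hη hm.measurable hm.nonneg (by positivity) hb ht).trans ?_
    refine mul_le_mul ?_ (exp_level_le hκ ht c) (Real.exp_pos _).le (by positivity)
    gcongr
    exact hη.norm_lowPass_le_of_memLp hp hp₂.le hθ₀
  have hexp : Real.exp (16 * c ^ 2 * κ) ^ 2 = Real.exp (32 * c ^ 2 * κ) := by
    rw [← Real.exp_nat_mul]
    ring_nf
  have hpow : (√q ^ (2 / p - 1)) ^ 2 = q ^ (2 / p - 1) := by
    rw [Real.rpow_pow_comm (Real.sqrt_nonneg q), Real.sq_sqrt hq]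
  calc ‖lowPass η (θ t)‖ ^ 2
      ≤ (2 * (√q ^ (2 / p - 1) * N + 4 * Real.pi * b * √q * Y) *
          Real.exp (16 * c ^ 2 * κ)) ^ 2 := by gcongr
    _ = 4 * Real.exp (32 * c ^ 2 * κ) *
          (√q ^ (2 / p - 1) * N + 4 * Real.pi * b * √q * Y) ^ 2 := by
        rw [← hexp]
        ring
    _ ≤ 4 * Real.exp (32 * c ^ 2 * κ) *
          (2 * ((√q ^ (2 / p - 1) * N) ^ 2 + (4 * Real.pi * b * √q * Y) ^ 2)) := by
        gcongr
        exact add_sq_le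
    _ = _ := by
        rw [mul_pow (√q ^ (2 / p - 1)), hpow, mul_pow _ Y, mul_pow _ √q, Real.sq_sqrt hq]
        ring

theorem IsWeakSolution.ofReal_le_dissipation (hθ : IsWeakSolution m θ₀ θ)
    (hm : IsComparableSymbol α β c m) (hα : 0 < α) (hα₁ : α ≤ 1) (hβ : 0 < β) (hβ₁ : β ≤ 1)
    (hp : 1 ≤ p) (hp₂ : p < 2) (hθ₀ : MemLp θ₀ (.ofReal p)) (hκ : 0 < κ) {t : ℝ} (ht : 0 ≤ t) :
    .ofReal (κ / (1 + t) * (‖θ t‖ ^ 2 - lowFrequencyBound (decayRate α β p) (anisotropicDim α β)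
      (dataCoeff α β c p (eLpNorm θ₀ (.ofReal p)).toReal κ) (transportCoeff α β c κ)
      (fun τ => ‖θ τ‖ ^ 2) t)) ≤ dissipation m (θ t) := by
  have hc := hm.pos
  have ht₁ : 1 ≤ 1 + t := by linarith
  have hh : 0 < c * κ / (1 + t) := by positivity
  obtain ⟨η, hη⟩ := hm.exists_isLowPass hα hα₁ hβ hβ₁ hh
  rw [mul_div_assoc, mul_div_cancel_left₀ _ hc.ne', ← mul_div_assoc] at hη
  refine le_trans ?_ (hη.le_dissipation (by positivity) hm.nonneg hm.measurable (θ t))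
  gcongr
  refine (hθ.sq_norm_lowPass_le hm hp hp₂ hθ₀ hκ ht (by positivity) (by positivity) hη).trans ?_
  have hdata : ((c * κ / (1 + t)) ^ anisotropicDim α β) ^ (2 / p - 1) =
      (c * κ) ^ decayRate α β p * (1 + t) ^ (-decayRate α β p) := by
    rw [← Real.rpow_mul hh.le, decayRate, Real.div_rpow (by positivity) (by positivity),
      Real.rpow_neg (by positivity), div_eq_mul_inv]
  have htransport := transport_level_le hα hα₁ hβ hβ₁ (mul_pos hc hκ) ht₁
  rw [hdata, lowFrequencyBound, dataCoeff, transportCoeff]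
  calc _ ≤ 8 * Real.exp (32 * c ^ 2 * κ) *
      ((c * κ) ^ decayRate α β p * (1 + t) ^ (-decayRate α β p) *
        (eLpNorm θ₀ (.ofReal p)).toReal ^ 2 + 16 * Real.pi ^ 2 *
        (2 * ((c * κ) ^ (1 / α + anisotropicDim α β) + (c * κ) ^ (1 / β + anisotropicDim α β)) *
          (1 + t) ^ (-(1 + anisotropicDim α β))) * (∫ τ in (0 : ℝ)..t, ‖θ τ‖ ^ 2) ^ 2) := by
        gcongr
    _ = _ := by ring

theorem IsWeakSolution.isSplitEnergy (hθ : IsWeakSolution m θ₀ θ)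
    (hm : IsComparableSymbol α β c m) (hα : 0 < α) (hα₁ : α ≤ 1) (hβ : 0 < β) (hβ₁ : β ≤ 1)
    (hp : 1 ≤ p) (hp₂ : p < 2) (hθ₀ : MemLp θ₀ (.ofReal p)) :
    IsSplitEnergy (‖θ₀‖ ^ 2) (decayRate α β p) (anisotropicDim α β)
      (dataCoeff α β c p (eLpNorm θ₀ (.ofReal p)).toReal) (transportCoeff α β c)
      (fun t => ‖θ t‖ ^ 2) := by
  have hstep {κ s t : ℝ} (hκ : 0 < κ) (hs : 0 ≤ s) (hst : s ≤ t) {w : L2R}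
      (hw : ‖θ t‖ₑ ^ 2 + 2 * ∫⁻ τ in Icc s t, dissipation m (θ τ) ≤ ‖w‖ₑ ^ 2) :
      ‖θ t‖ ^ 2 + ∫ τ in s..t, 2 * (κ / (1 + τ)) * (‖θ τ‖ ^ 2 -
        lowFrequencyBound (decayRate α β p) (anisotropicDim α β)
          (dataCoeff α β c p (eLpNorm θ₀ (.ofReal p)).toReal κ) (transportCoeff α β c κ)
          (fun τ => ‖θ τ‖ ^ 2) τ) ≤ ‖w‖ ^ 2 := by
    simp only [mul_assoc (2 : ℝ)]
    refine norm_sq_add_integral_le hst ?_ (fun τ hτ =>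
      hθ.ofReal_le_dissipation hm hα hα₁ hβ hβ₁ hp hp₂ hθ₀ hκ (hs.trans hτ.1)) hw
    have hsub : uIcc s t ⊆ Icc 0 t := by
      rw [uIcc_of_le hst]
      exact Icc_subset_Icc_left hs
    have hF := continuousOn_lowFrequencyBound (decayRate α β p) (anisotropicDim α β)
      (dataCoeff α β c p (eLpNorm θ₀ (.ofReal p)).toReal κ) (transportCoeff α β c κ)
      (hs.trans hst) (hθ.intervalIntegrable_norm_sq le_rfl (hs.trans hst))
    refine ((hθ.intervalIntegrable_norm_sq hs hst).sub
      (hF.mono hsub).intervalIntegrable).continuousOn_mul ?_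
    exact continuousOn_const.div (by fun_prop) fun τ hτ => by linarith [(hsub hτ).1]
  exact {
    aestronglyMeasurable := hθ.aestronglyMeasurable_norm_sq
    nonneg := fun _ _ => sq_nonneg _
    le := fun t ht => by
      gcongr
      exact hθ.norm_le ht
    energy_zero := fun κ hκ t ht => hstep hκ le_rfl ht (hθ.energy_zero t ht)
    energy := fun κ hκ => by
      filter_upwards [hθ.energy, ae_restrict_mem measurableSet_Ici] with s hs hs₀ t hst
      exact hstep hκ hs₀ hst (hs t hst) }

theorem exists_sq_norm_le (hm : IsComparableSymbol α β c m) (hα : 0 < α) (hα₁ : α ≤ 1)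
    (hβ : 0 < β) (hβ₁ : β ≤ 1) (hp : 1 ≤ p) (hp₂ : p < 2) (hθ₀ : MemLp θ₀ (.ofReal p)) :
    ∃ C, ∀ θ, IsWeakSolution m θ₀ θ → ∀ t, 0 ≤ t →
      ‖θ t‖ ^ 2 ≤ C * (1 + t) ^ (-decayRate α β p) := by
  obtain ⟨C, hC⟩ := IsSplitEnergy.exists_decay (E := ‖θ₀‖ ^ 2)
    (A := dataCoeff α β c p (eLpNorm θ₀ (.ofReal p)).toReal) (one_le_anisotropicDim hα hα₁ hβ hβ₁)
    (decayRate_pos hα hβ (by linarith) hp₂) (decayRate_le_anisotropicDim hα hβ hp)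
    (fun _ => dataCoeff_nonneg α β p _ hm.pos)
    (fun _ => transportCoeff_nonneg α β hm.pos) (tendsto_transportCoeff hα hβ c)
    (sq_nonneg ‖θ₀‖)
  exact ⟨C, fun θ hθ => hC _ (hθ.isSplitEnergy hm hα hα₁ hβ hβ₁ hp hp₂ hθ₀)⟩

end Decay

end AnisoSQG

theorem proposition3p2_general {α β c p : ℝ} {m : AnisoSQG.Plane → ℝ} (hα : 0 < α ∧ α ≤ 1)
    (hβ : 0 < β ∧ β ≤ 1) (hp : 1 ≤ p ∧ p < 2) (hm : AnisoSQG.IsComparableSymbol α β c m)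
    (θ₀ : AnisoSQG.L2R) (hθ₀ : MemLp θ₀ (ENNReal.ofReal p) volume) :
    ∃ C : ℝ, 0 < C ∧ ∀ θ : ℝ → AnisoSQG.L2R, AnisoSQG.IsWeakSolution m θ₀ θ →
      ∀ t : ℝ, 0 ≤ t → ‖θ t‖ ≤ C * (1 + t) ^ (-((α + β) * (2 - p) / (4 * α * β * p))) := by
  obtain ⟨C, hC⟩ := AnisoSQG.exists_sq_norm_le hm hα.1 hα.2 hβ.1 hβ.2 hp.1 hp.2 hθ₀
  refine ⟨√(max C 1), by positivity, fun θ hθ t ht => ?_⟩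
  have hrate := AnisoSQG.decayRate_eq hα.1.ne' hβ.1.ne' (by linarith : p ≠ 0)
  have hsq : ‖θ t‖ ^ 2 ≤
      max C 1 * ((1 + t) ^ (-((α + β) * (2 - p) / (4 * α * β * p)))) ^ 2 := by
    rw [← Real.rpow_mul_natCast (by positivity), Nat.cast_ofNat, neg_mul, ← hrate]
    refine (hC θ hθ t ht).trans ?_
    gcongr
    exact le_max_left C 1
  refine le_of_sq_le_sq ?_ (by positivity)
  rwa [mul_pow, Real.sq_sqrt (by positivity)]

theorem proposition3p2 (α β p : ℝ) (hα : 0 < α ∧ α ≤ 1) (hβ : 0 < β ∧ β ≤ 1)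
    (hp : 1 ≤ p ∧ p < 2)
    (m : AnisoSQG.Plane → ℝ)
    (hm : m = AnisoSQG.anisotropicSymbol α β ∨ (α = β ∧ m = AnisoSQG.isotropicSymbol α))
    (θ₀ : AnisoSQG.L2R)
    (hθ₀ : MemLp θ₀ (ENNReal.ofReal p) (volume : Measure AnisoSQG.Plane)) :
    ∃ C : ℝ, 0 < C ∧
      ∀ θ : ℝ → AnisoSQG.L2R, AnisoSQG.IsWeakSolution m θ₀ θ →
        ∀ t : ℝ, 0 ≤ t →
          ‖θ t‖ ≤ C * (1 + t) ^ (-((α + β) * (2 - p) / (4 * α * β * p))) := by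
  rcases hm with rfl | ⟨rfl, rfl⟩
  · exact proposition3p2_general hα hβ hp
      (AnisoSQG.isComparableSymbol_anisotropicSymbol α β) θ₀ hθ₀
  · exact proposition3p2_general hα hα hp
      (AnisoSQG.isComparableSymbol_isotropicSymbol hα.1 hα.2) θ₀ hθ₀
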